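/- Let $A=\{a,b\}$ and let $A^*$ be the set of words over $A$ under subword order: $u\le w$ if $u$ is obtained from $w$ by deleting letters. For $d\ge 0$ let $A^*_d$ be the subposet of words without $d+1$ consecutive $b$'s, and let $[u,w]_d$ denote an interval of $A^*_d$. A set $\iota\subseteq\{1,\dots,|w|\}$ is an embedding of $u$ in $w=w_1\cdots w_n$ if the letters of $w$ at the positions in $\iota$, read from left to right, form $u$. Björner's labeling. Let $w=x_0\succ x_1\succ\dots\succ x_k=u$ be a maximal chain of an interval of $A^*$, and let $S_0=\{1,\dots,|w|\}$. For $j=1,\dots,k$ the edge $(x_{j-1},x_j)$ gets as label $i_j$, the least $i\in S_{j-1}$ such that $S_{j-1}\setminus\{i\}$ is an embedding of $x_j$ in $w$, and $S_j=S_{j-1}\setminus\{i_j\}$. A dual CL-labeling of a graded interval $[u,w]$ assigns integers to the edges of each maximal chain so that (i) if two maximal chains have the same first $s$ edges from the top, then these edges have the same labels in both; (ii) for all $u\le x\le y\le w$ and each maximal chain $r$ of $[y,w]$, exactly one maximal chain of $[x,y]$ has weakly increasing labels (read from top to bottom, in a maximal chain of $[u,w]$ that contains $r$), and its label sequence is lexicographically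 strictly smaller than that of every other maximal chain of $[x,y]$. **Theorem.** Let $d\ge 0$. 1. For all $u\le w$ in $A^*_d$, every maximal chain of $[u,w]_d$ is a maximal chain of the interval $[u,w]$ of $A^*$, and the restriction of Björner's labeling to the maximal chains of $[u,w]_d$ is a dual CL-labeling of $[u,w]_d$. 2. Hence $A^*_d$ is (dual) CL-shellable, that is, each of its intervals has a dual CL-labeling; and the order complex of each interval $[u,w]_d$ is pure and shellable. 3. For all $u,w\in A^*_d$ the number of maximal chains of $[u,w]_d$ whose labels, read from top to bottom, are strictly decreasing equals the number $\binom{w}{u}_{dn}$ of $d$-normal embeddings of $u$ in $w$, and the Möbius function of $A^*_d$ is $$\mu(u,w)=(-1)^{|w|+|u|}\binom{w}{u}_{dn}.$$ Here an embedding $\iota=\{i_1<\dots<i_k\}$ of $u$ in $w$ is $d$-normal if (a) $\iota$ contains every $j\ge 2$ with $w_j=w_{j-1}$; (b) whenever a run of $d$ $b$'s of $u$, with a first letter $u_j$, $j>1$, is not at the beginning of $u$, then $w_{i_j-1}=a$ and $i_j-1\in\iota$; (c) if $u$ begins with $d\geq 1$ $b$'s, then $i_1=1$, or $i_1=2$ and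 $w_1=a$. -/

import Mathlib

/-! ### Words over a two-letter alphabet under subword order -/

/-- The alphabet `A = {a, b}`. -/
inductive Letter : Type
  | a : Letter
  | b : Letter
  deriving DecidableEq

/-- The set `A*` of all words over `A`. (A structure, so that it does not inherit the
lexicographic order of `List`.) -/
@[ext]
structure Word : Type where
  letters : List Letter
  deriving DecidableEq

namespace Word

/-- The length `|w|`. -/
def length (w : Word) : ℕ := w.letters.length

/-- Subword order: `u ≤ w` if `u` is obtained from `w` by deleting letters. -/
instance instPartialOrder : PartialOrder Word where
  le u w := u.letters.Sublist w.letters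
  le_refl u := List.Sublist.refl u.letters
  le_trans _ _ _ h₁ h₂ := List.Sublist.trans h₁ h₂
  le_antisymm _ _ h₁ h₂ := Word.ext (List.Sublist.antisymm h₁ h₂)

instance instDecidableLE : DecidableLE Word := fun u w =>
  inferInstanceAs (Decidable (u.letters.Sublist w.letters))

instance instLocallyFiniteOrder : LocallyFiniteOrder Word :=
  LocallyFiniteOrder.ofIcc Word
    (fun u w => ((w.letters.sublists.map Word.mk).toFinset).filter (fun v => u ≤ v ∧ v ≤ w))
    (by
      intro u w v
      simp only [Finset.mem_filter, List.mem_toFinset, List.mem_map, List.mem_sublists,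
        and_iff_right_iff_imp]
      exact fun h => ⟨v.letters, h.2, rfl⟩)

/-- The letter `w_i`, with positions numbered `1, …, |w|`; `none` at all other positions. -/
def letterAt (w : Word) : ℕ → Option Letter
  | 0 => none
  | i + 1 => w.letters[i]?

/-- The word `w_ι` formed by the letters of `w` whose positions lie in `ι`, from left to right. -/
def restrict (w : Word) (ι : Finset ℕ) : Word :=
  ⟨((w.letters.zipIdx 1).filter (fun p => p.2 ∈ ι)).map Prod.fst⟩

/-- `ι ⊆ {1, …, |w|}` is an embedding of `u` in `w`, that is, `w_ι = u`. -/
def IsEmbedding (u w : Word) (ι : Finset ℕ) : Prop :=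
  ι ⊆ Finset.Icc 1 w.length ∧ w.restrict ι = u

/-- `w` has no `d + 1` consecutive letters `b`. -/
def RunsLE (d : ℕ) (w : Word) : Prop :=
  ¬ List.replicate (d + 1) Letter.b <:+: w.letters

instance instDecidablePredRunsLE (d : ℕ) : DecidablePred (RunsLE d) := fun w =>
  inferInstanceAs (Decidable (¬ List.replicate (d + 1) Letter.b <:+: w.letters))

/-- The repetition set `R(w) = {j : w_j = w_{j-1}}`. -/
def repetitionSet (w : Word) : Finset ℕ :=
  (Finset.Icc 2 w.length).filter (fun j => w.letterAt j = w.letterAt (j - 1))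

/-- A run of `d` letters `b` of `u` starts at position `r`. For `d = 0` there is no such run with a
first letter in a word without letters `b`. -/
def BRunAt (d : ℕ) (u : Word) (r : ℕ) : Prop :=
  u.letterAt r = some Letter.b ∧ ∀ t < d, u.letterAt (r + t) = some Letter.b

/-- `d`-normal embeddings of `u` in `w`. For `p ∈ ι` the number `#{q ∈ ι : q ≤ p}` is the position
`j` of the letter `u_j` that is placed at `p`, so that `p = i_j`. -/
structure IsNormalEmbedding (d : ℕ) (u w : Word) (ι : Finset ℕ) : Prop where
  isEmbedding : IsEmbedding u w ι
  repetition : w.repetitionSet ⊆ ι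
  /-- A run of `d` letters `b` not at the beginning of `u` is placed directly behind a supported
  letter `a` of `w`. -/
  inner_run : ∀ p ∈ ι, 1 < (ι.filter (· ≤ p)).card → BRunAt d u (ι.filter (· ≤ p)).card →
    w.letterAt (p - 1) = some Letter.a ∧ p - 1 ∈ ι
  /-- A run of `d` letters `b` at the beginning of `u` is placed at the beginning of `w`, or
  directly behind an initial letter `a` of `w`. -/
  initial_run : ∀ p ∈ ι, (ι.filter (· ≤ p)).card = 1 → BRunAt d u 1 →
    p = 1 ∨ (p = 2 ∧ w.letterAt 1 = some Letter.a)

end Word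

/-- The subposet `A*_d` of `A*`: the words without `d + 1` consecutive letters `b`. -/
abbrev RestrictedWord (d : ℕ) : Type := {w : Word // Word.RunsLE d w}

/-! ### Dual CL-labelings of intervals -/

/-- `c = (x₀, x₁, …, x_k)` is a maximal chain of the interval `[u, w]`, listed from the top
`x₀ = w` to the bottom `x_k = u`. -/
def IsMaximalChain {α : Type*} [PartialOrder α] (u w : α) (c : List α) : Prop :=
  c.IsChain (fun x y => y ⋖ x) ∧ c.head? = some w ∧ c.getLast? = some u

/-- The part of the label sequence of the maximal chain `r ∪ m ∪ t` of `[u, w]` that belongs to the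
edges of `m`; here `r`, `m`, `t` are maximal chains of `[y, w]`, `[x, y]`, `[u, x]`. -/
def rootedLabels {α : Type*} (ℓ : List α → List ℤ) (r m t : List α) : List ℤ :=
  ((ℓ (r ++ m.tail ++ t.tail)).drop (r.length - 1)).take (m.length - 1)

/-- `ℓ`, which assigns to each maximal chain of `[u, w]` the sequence of the labels of its edges
read from top to bottom, is a dual CL-labeling of the (graded) interval `[u, w]`. -/
structure IsDualCLLabeling {α : Type*} [PartialOrder α] (u w : α) (ℓ : List α → List ℤ) :
    Prop where
  /-- All maximal chains have the same length. -/
  graded : ∀ c c', IsMaximalChain u w c → IsMaximalChain u w c' → c.length = c'.length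
  /-- There is one label for each edge. -/
  length_eq : ∀ c, IsMaximalChain u w c → (ℓ c).length = c.length - 1
  /-- If two maximal chains have the same first `s` edges from the top, then these edges have the
  same labels in both. -/
  prefix_eq : ∀ c c', IsMaximalChain u w c → IsMaximalChain u w c' →
    ∀ s, s < c.length → c.take (s + 1) = c'.take (s + 1) → (ℓ c).take s = (ℓ c').take s
  /-- Each rooted interval `[x, y]_r`, with root a maximal chain `r` of `[y, w]`, has a unique
  maximal chain `m` with weakly increasing labels, and the labels of `m` are lexicographically
  strictly smaller than those of all other maximal chains. By `prefix_eq` the labels do not depend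
  on the maximal chain `t` of `[u, x]` used to complete a chain. -/
  rooted : ∀ x y, u ≤ x → x ≤ y → y ≤ w → ∀ r t, IsMaximalChain y w r → IsMaximalChain u x t →
    ∃ m, IsMaximalChain x y m ∧ (rootedLabels ℓ r m t).Pairwise (· ≤ ·) ∧
      ∀ m', IsMaximalChain x y m' → m' ≠ m →
        ¬ (rootedLabels ℓ r m' t).Pairwise (· ≤ ·) ∧
        List.Lex (· < ·) (rootedLabels ℓ r m t) (rootedLabels ℓ r m' t)

/-- A poset is dual CL-shellable if each of its intervals has a dual CL-labeling. -/
def IsDualCLShellable (α : Type*) [PartialOrder α] : Prop :=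
  ∀ u w : α, u ≤ w → ∃ ℓ : List α → List ℤ, IsDualCLLabeling u w ℓ

/-! ### Shellability of order complexes -/

/-- The order complex of `[u, w]`: its faces are the non-empty finite chains of `[u, w]`. -/
def orderComplex {α : Type*} [PartialOrder α] (u w : α) : PreAbstractSimplicialComplex α where
  faces := {s | s.Nonempty ∧ (s : Set α) ⊆ Set.Icc u w ∧ IsChain (· ≤ ·) (s : Set α)}
  isRelLowerSet_faces := by
    intro s hs
    refine ⟨hs.1, fun t hts ht => ⟨ht, ?_, ?_⟩⟩
    · exact (Finset.coe_subset.mpr hts).trans hs.2.1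
    · exact hs.2.2.mono (Finset.coe_subset.mpr hts)

/-- A finite-dimensional pure complex with finitely many facets is shellable if its facets can be
listed as `F₁, …, F_n` such that for `i < j` there is `k < j` for which `F_k ∩ F_j` contains
`F_i ∩ F_j` and has one element less than `F_j`. -/
def IsShellable {α : Type*} [DecidableEq α] (K : PreAbstractSimplicialComplex α) : Prop :=
  (∀ s t, Maximal (· ∈ K) s → Maximal (· ∈ K) t → s.card = t.card) ∧
  ∃ (n : ℕ) (F : Fin n → Finset α), Function.Injective F ∧
    (∀ s, Maximal (· ∈ K) s ↔ ∃ i, F i = s) ∧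
    ∀ i j, i < j → ∃ k, k < j ∧ F i ∩ F j ⊆ F k ∩ F j ∧ (F k ∩ F j).card + 1 = (F j).card

/-! ### Björner's labeling -/

/-- Labels of the edges below a word that is embedded in `w` at the positions `S`: the first edge,
which leads down to `x`, has as label the least `i ∈ S` such that `S - {i}` is an embedding of `x`
in `w`, and the procedure goes on with `S - {i}`. -/
noncomputable def deletionLabels (w : Word) : Finset ℕ → List Word → List ℕ
  | _, [] => []
  | S, x :: xs =>
    let i := sInf {i : ℕ | i ∈ S ∧ Word.IsEmbedding x w (S.erase i)}
    i :: deletionLabels w (S.erase i) xs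

/-- Björner's labeling of the maximal chains `w = x₀, x₁, …` of intervals of `A*`, listed from top to
bottom. -/
noncomputable def bjornerLabeling : List Word → List ℤ
  | [] => []
  | w :: xs => (deletionLabels w (Finset.Icc 1 w.length) xs).map (fun i => (i : ℤ))

/-- The restriction of Björner's labeling to `A*_d`. -/
noncomputable def restrictedLabeling (d : ℕ) (c : List (RestrictedWord d)) : List ℤ :=
  bjornerLabeling (c.map Subtype.val)

/-- The maximal chains of the interval `[u, w]_d` of `A*_d` with strictly decreasing labels. -/
def descendingChains (d : ℕ) (u w : RestrictedWord d) : Set (List (RestrictedWord d)) :=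
  {c | IsMaximalChain u w c ∧ (restrictedLabeling d c).Pairwise (· > ·)}

/-!
A maximal chain from `w` down deletes one position at a time, and the least possible position is
the head of a run of equal letters of the word reached so far. Björner's labeling thus identifies
the chains of `[x, y]_d` below a word embedded at `S` with the sequences of run heads whose
successive deletion from `S` stays in `A*_d` and ends at an embedding of `x`. If the labels
increase, the final embedding is the rightmost one inside `S`, which is unique. Deleting the
complement of the rightmost embedding from left to right never creates a run of more than `d`
letters `b`, and any other sequence with the same result is lexicographically larger.

The Möbius function is read off from the identity `∑ x ∈ [u, w], (-1) ^ (|w| - |x|) * f x w = 0`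
for `u < w`, where `f x w` counts the chains of `[x, w]` with decreasing labels: a chain of
`[u, w]` that decreases down to `x` and increases below `x` splits in exactly two ways, at adjacent
elements, so the contributions cancel. A decreasing sequence deletes from right to left,
so that at the moment of deleting `i` the word consists of the letters of `w` in front of `i` and of
those of the target embedding behind `i`; that all these words lie in `A*_d` is `d`-normality.
-/

/-! ### Maximal chains and facets of the order complex -/

namespace IsMaximalChain

variable {α : Type*} [PartialOrder α] {u w x y z : α} {c c' m r : List α}

theorem exists_cons (h : IsMaximalChain u w c) : ∃ q, c = w :: q :=
  List.head?_eq_some_iff.1 h.2.1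

theorem exists_append (h : IsMaximalChain u w c) : ∃ p, c = p ++ [u] :=
  List.getLast?_eq_some_iff.1 h.2.2

theorem length_pos (h : IsMaximalChain u w c) : 0 < c.length := by
  obtain ⟨q, rfl⟩ := h.exists_cons
  simp

theorem append_cons_iff {p q : List α} :
    IsMaximalChain u w (p ++ x :: q) ↔
      IsMaximalChain x w (p ++ [x]) ∧ IsMaximalChain u x (x :: q) := by
  have head_eq : (p ++ x :: q).head? = (p ++ [x]).head? := by cases p <;> simp
  have last_eq : (p ++ x :: q).getLast? = (x :: q).getLast? :=
    List.getLast?_append_of_ne_nil _ (by simp)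
  have last_append : (p ++ [x]).getLast? = some x := by simp
  rw [IsMaximalChain, IsMaximalChain, IsMaximalChain, List.isChain_split, head_eq, last_eq,
    List.head?_cons]
  tauto

theorem cons_cons_iff {q : List α} :
    IsMaximalChain u w (w :: x :: q) ↔ x ⋖ w ∧ IsMaximalChain u x (x :: q) := by
  rw [← List.singleton_append, append_cons_iff]
  simp [IsMaximalChain]

theorem append (hr : IsMaximalChain y w r) (hm : IsMaximalChain x y m) :
    IsMaximalChain x w (r ++ m.tail) := by
  obtain ⟨p, rfl⟩ := hr.exists_append
  obtain ⟨q, rfl⟩ := hm.exists_cons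
  simpa using append_cons_iff.2 ⟨hr, hm⟩

theorem pairwise (h : IsMaximalChain u w c) : c.Pairwise (· > ·) :=
  List.isChain_iff_pairwise.1 (h.1.imp fun _ _ hxy => hxy.lt)

theorem nodup (h : IsMaximalChain u w c) : c.Nodup :=
  h.pairwise.imp fun hab => hab.ne'

theorem mem_Icc (h : IsMaximalChain u w c) (hz : z ∈ c) : z ∈ Set.Icc u w := by
  have hp := h.pairwise
  constructor
  · obtain ⟨p, rfl⟩ := h.exists_append
    rcases List.mem_append.1 hz with hz | hz
    · exact ((List.pairwise_append.1 hp).2.2 z hz u (List.mem_singleton_self u)).le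
    · exact (List.mem_singleton.1 hz).ge
  · obtain ⟨q, rfl⟩ := h.exists_cons
    rcases List.mem_cons.1 hz with hz | hz
    · exact hz.le
    · exact ((List.pairwise_cons.1 hp).1 z hz).le

theorem le (h : IsMaximalChain u w c) : u ≤ w :=
  (h.mem_Icc (List.mem_of_mem_head? h.2.1)).1

theorem self_iff : IsMaximalChain u u c ↔ c = [u] := by
  refine ⟨fun h => ?_, by rintro rfl; simp [IsMaximalChain]⟩
  obtain ⟨q, rfl⟩ := h.exists_cons
  refine congrArg (u :: ·) (List.eq_nil_iff_forall_not_mem.2 fun z hz => ?_)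
  have hlt : z < u := (List.pairwise_cons.1 h.pairwise).1 z hz
  exact hlt.not_ge (h.mem_Icc (List.mem_cons_of_mem u hz)).1

theorem mem_of_comparable (h : IsMaximalChain u w c) (huz : u ≤ z) (hzw : z ≤ w)
    (hz : ∀ y ∈ c, y ≤ z ∨ z ≤ y) : z ∈ c := by
  obtain ⟨q, rfl⟩ := h.exists_cons
  induction q generalizing w with
  | nil =>
    have hw : w = u := by simpa [IsMaximalChain] using h
    simp [le_antisymm hzw (hw ▸ huz)]
  | cons x q ih =>
    obtain ⟨hcov, hx⟩ := cons_cons_iff.1 h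
    rcases hz x (by simp) with hxz | hzx
    · rcases hcov.eq_or_eq hxz hzw with rfl | rfl <;> simp
    · exact List.mem_cons_of_mem _ (ih hzx hx fun y hy => hz y (List.mem_cons_of_mem _ hy))

theorem grade_add_one [GradeOrder ℕ α] (h : IsMaximalChain u w c) :
    grade ℕ w + 1 = grade ℕ u + c.length := by
  obtain ⟨q, rfl⟩ := h.exists_cons
  induction q generalizing w with
  | nil =>
    have hw : w = u := by simpa [IsMaximalChain] using h
    simp [hw]
  | cons x q ih =>
    obtain ⟨hcov, hx⟩ := cons_cons_iff.1 h
    have hgrade : grade ℕ x + 1 = grade ℕ w := Order.covBy_iff_add_one_eq.1 (hcov.grade ℕ)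
    have := ih hx
    simp only [List.length_cons] at this ⊢
    omega

end IsMaximalChain

section Facets

variable {α : Type*} [PartialOrder α] {u w : α} {c c' : List α}

theorem IsMaximalChain.toFinset_mem_orderComplex [DecidableEq α] (h : IsMaximalChain u w c) :
    c.toFinset ∈ orderComplex u w := by
  have comparable : c.Pairwise fun y z => y ≤ z ∨ z ≤ y := h.pairwise.imp fun hyz => Or.inr hyz.le
  have : Std.Symm fun y z : α => y ≤ z ∨ z ≤ y := ⟨fun _ _ => Or.symm⟩
  refine ⟨List.toFinset_nonempty_iff c |>.2 (List.ne_nil_of_length_pos h.length_pos),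
    fun z hz => h.mem_Icc (List.mem_toFinset.1 hz), fun y hy z hz hyz => ?_⟩
  exact comparable.forall (List.mem_toFinset.1 hy) (List.mem_toFinset.1 hz) hyz

theorem IsMaximalChain.maximal_toFinset [DecidableEq α] (h : IsMaximalChain u w c) :
    Maximal (· ∈ orderComplex u w) c.toFinset := by
  refine ⟨h.toFinset_mem_orderComplex, fun t ⟨_, hsub, hchain⟩ hct z hz => ?_⟩
  rw [List.mem_toFinset]
  exact h.mem_of_comparable (hsub hz).1 (hsub hz).2 fun y hy =>
    hchain.total (hct (List.mem_toFinset.2 hy)) hz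

theorem IsMaximalChain.eq_of_toFinset_eq [DecidableEq α] (h : IsMaximalChain u w c)
    (h' : IsMaximalChain u w c') (heq : c.toFinset = c'.toFinset) : c = c' :=
  List.Perm.eq_of_pairwise' h.pairwise h'.pairwise
    (List.perm_of_nodup_nodup_toFinset_eq h.nodup h'.nodup heq)

variable [LocallyFiniteOrder α]

theorem exists_isMaximalChain (huw : u ≤ w) : ∃ c, IsMaximalChain u w c := by
  induction le_iff_reflTransGen_covBy.1 huw with
  | refl => exact ⟨[u], IsMaximalChain.self_iff.2 rfl⟩
  | @tail y z huy hyz ih =>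
    obtain ⟨c, hc⟩ := ih (le_iff_reflTransGen_covBy.2 huy)
    obtain ⟨q, rfl⟩ := hc.exists_cons
    exact ⟨z :: y :: q, IsMaximalChain.cons_cons_iff.2 ⟨hyz, hc⟩⟩

theorem exists_isMaximalChain_of_isChain [DecidableEq α] {s : Finset α} (huw : u ≤ w)
    (hsub : (s : Set α) ⊆ Set.Icc u w) (hs : IsChain (· ≤ ·) (s : Set α)) :
    ∃ c, IsMaximalChain u w c ∧ s ⊆ c.toFinset := by
  induction s using Finset.strongInduction generalizing w with
  | H s ih =>
    rcases s.eq_empty_or_nonempty with rfl | hne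
    · obtain ⟨c, hc⟩ := exists_isMaximalChain huw
      exact ⟨c, hc, Finset.empty_subset _⟩
    · obtain ⟨x, hx⟩ := s.exists_maximal hne
      obtain ⟨hux, hxw⟩ := hsub hx.prop
      have hle : ∀ z ∈ s, z ≤ x := fun z hz => (hs.total hz hx.prop).elim id (hx.le_of_ge hz)
      obtain ⟨c, hc, hsc⟩ := ih (s.erase x) (Finset.erase_ssubset hx.prop) hux
        (fun z hz => ⟨(hsub (Finset.mem_of_mem_erase hz)).1, hle z (Finset.mem_of_mem_erase hz)⟩)
        (hs.mono (Finset.coe_subset.2 (Finset.erase_subset x s)))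
      obtain ⟨r, hr⟩ := exists_isMaximalChain hxw
      obtain ⟨p, rfl⟩ := hr.exists_append
      obtain ⟨q, rfl⟩ := hc.exists_cons
      refine ⟨_, hr.append hc, ?_⟩
      rw [← Finset.insert_erase hx.prop]
      exact Finset.insert_subset (by simp) (hsc.trans fun z hz => by
        simp only [List.mem_toFinset, List.mem_cons, List.mem_append, List.tail_cons] at hz ⊢
        tauto)

theorem maximal_mem_orderComplex_iff [DecidableEq α] {s : Finset α} :
    Maximal (· ∈ orderComplex u w) s ↔ ∃ c, IsMaximalChain u w c ∧ c.toFinset = s := by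
  refine ⟨fun hs => ?_, by rintro ⟨c, hc, rfl⟩; exact hc.maximal_toFinset⟩
  obtain ⟨⟨z, hz⟩, hsub, hchain⟩ := hs.prop
  obtain ⟨c, hc, hsc⟩ :=
    exists_isMaximalChain_of_isChain ((hsub hz).1.trans (hsub hz).2) hsub hchain
  exact ⟨c, hc, (hs.eq_of_le hc.toFinset_mem_orderComplex hsc).symm⟩

theorem finite_setOf_isMaximalChain (u w : α) : {c | IsMaximalChain u w c}.Finite := by
  classical
  refine Set.Finite.of_finite_image (f := List.toFinset)
    ((Finset.finite_toSet (Finset.Icc u w).powerset).subset ?_) fun c hc c' hc' h =>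
      hc.eq_of_toFinset_eq hc' h
  rintro _ ⟨c, hc, rfl⟩
  rw [Finset.mem_coe, Finset.mem_powerset]
  exact fun z hz => Finset.mem_Icc.2 (hc.mem_Icc (List.mem_toFinset.1 hz))

end Facets

/-! ### Shellability of intervals with a dual CL-labeling -/

section Lists

variable {β : Type*}

theorem list_lt_of_take_lt_take [LT β] {n : ℕ} {l l' : List β} (h : l.take n < l'.take n) :
    l < l' := by
  induction n generalizing l l' with
  | zero => simp at h
  | succ n ih =>
    rcases l with _ | ⟨a, l⟩ <;> rcases l' with _ | ⟨b, l'⟩ <;>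
      simp_all only [List.take_nil, List.take_succ_cons, List.nil_lt_cons, List.cons_lt_cons_iff,
        List.not_lt_nil]
    exact h.imp_right fun ⟨hab, hlt⟩ => ⟨hab, ih hlt⟩

theorem list_lt_of_drop_lt_drop [LT β] {k : ℕ} {l l' : List β} (htake : l.take k = l'.take k)
    (hdrop : l.drop k < l'.drop k) : l < l' := by
  rw [← List.take_append_drop k l, ← List.take_append_drop k l', htake]
  exact List.Lex.append_left _ hdrop _

theorem exists_fork {a : β} {l l' : List β} (hne : l ≠ l') :
    ∃ p x s s', a :: l = p ++ x :: s ∧ a :: l' = p ++ x :: s' ∧ s.head? ≠ s'.head? := by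
  by_cases hhead : l.head? = l'.head?
  · induction l generalizing a l' with
    | nil => simp_all [eq_comm]
    | cons b l ih =>
      obtain ⟨q, rfl⟩ := List.head?_eq_some_iff.1 hhead.symm
      by_cases htail : l.head? = q.head?
      · obtain ⟨p, x, s, s', hl, hq, hs⟩ := ih (a := b) (fun h => hne (by rw [h])) htail
        exact ⟨a :: p, x, s, s', by rw [hl]; rfl, by rw [hq]; rfl, hs⟩
      · exact ⟨[a], b, l, q, rfl, rfl, htail⟩
  · exact ⟨[], a, l, l', rfl, rfl, hhead⟩

theorem exists_first_common {s s' : List β} {z : β} (hz : z ∈ s) (hz' : z ∈ s') :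
    ∃ m y q m' q', s = m ++ y :: q ∧ s' = m' ++ y :: q' ∧ ∀ k ∈ m', k ∉ s := by
  classical
  obtain ⟨y, hy⟩ := Option.isSome_iff_exists.1
    ((List.find?_isSome (p := fun k => decide (k ∈ s))).2 ⟨z, hz', decide_eq_true hz⟩)
  obtain ⟨hys, m', q', hs', hm'⟩ := List.find?_eq_some_iff_append.1 hy
  obtain ⟨m, q, hs⟩ := List.append_of_mem (of_decide_eq_true hys)
  exact ⟨m, y, q, m', q', hs, hs', fun k hk => by simpa using hm' k hk⟩

theorem exists_eq_append_cons_cons_cons {l : List β} {k : ℕ} (hk : k + 1 + 1 < l.length) :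
    ∃ P e f g Q, l = P ++ e :: f :: g :: Q ∧ P.length = k := by
  obtain ⟨hk₀, hk₁⟩ : k < l.length ∧ k + 1 < l.length := by omega
  refine ⟨l.take k, l[k], l[k + 1], l[k + 1 + 1], l.drop (k + 1 + 1 + 1), ?_,
    List.length_take_of_le hk₀.le⟩
  rw [List.getElem_cons_drop hk, List.getElem_cons_drop hk₁, List.getElem_cons_drop hk₀,
    List.take_append_drop]

theorem exists_getElem_lt_of_not_pairwise_le [LinearOrder β] {l : List β}
    (h : ¬ l.Pairwise (· ≤ ·)) : ∃ (k : ℕ) (hk : k + 1 < l.length), l[k + 1] < l[k] := by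
  rw [← List.isChain_iff_pairwise, List.isChain_iff_getElem] at h
  push Not at h
  exact h

theorem toFinset_set_inter_toFinset [DecidableEq β] {l : List β} (hl : l.Nodup) {i : ℕ}
    (hi : i < l.length) {z : β} (hz : z ≠ l[i]) :
    (l.set i z).toFinset ∩ l.toFinset = l.toFinset.erase l[i] := by
  ext k
  simp only [Finset.mem_inter, List.mem_toFinset, Finset.mem_erase, List.mem_iff_getElem,
    List.length_set]
  constructor
  · rintro ⟨⟨j, hj, rfl⟩, hmem⟩
    refine ⟨?_, hmem⟩
    rcases eq_or_ne i j with rfl | hij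
    · simpa using hz
    · simpa [List.getElem_set_ne hij, hl.getElem_inj_iff] using hij.symm
  · rintro ⟨hne, j, hj, rfl⟩
    have hij : i ≠ j := by
      rintro rfl
      exact hne rfl
    exact ⟨⟨j, hj, List.getElem_set_ne hij _⟩, j, hj, rfl⟩

end Lists

theorem IsMaximalChain.exists_diverge {α : Type*} [PartialOrder α] {u w : α} {c c' : List α}
    (hc : IsMaximalChain u w c) (hc' : IsMaximalChain u w c') (hne : c ≠ c') :
    ∃ p x m y q m' q', c = p ++ x :: (m ++ y :: q) ∧ c' = p ++ x :: (m' ++ y :: q') ∧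
      m ≠ m' ∧ ∀ k ∈ m', k ∉ c := by
  obtain ⟨l, rfl⟩ := hc.exists_cons
  obtain ⟨l', rfl⟩ := hc'.exists_cons
  obtain ⟨p, x, s, s', hl, hl', hs⟩ := exists_fork (a := w) (fun h : l = l' => hne (by rw [h]))
  rw [hl] at hc ⊢
  rw [hl'] at hc' ⊢
  have hx := (IsMaximalChain.append_cons_iff.1 hc).2
  have hx' := (IsMaximalChain.append_cons_iff.1 hc').2
  have mem_tail : ∀ {t t' : List α}, IsMaximalChain u x (x :: t) → IsMaximalChain u x (x :: t') →
      t.head? ≠ t'.head? → u ∈ t := by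
    intro t t' ht _ _
    rcases List.mem_cons.1 (List.mem_of_getLast? ht.2.2) with rfl | hu
    · simp_all [IsMaximalChain.self_iff]
    · exact hu
  obtain ⟨m, y, q, m', q', rfl, rfl, hm'⟩ :=
    exists_first_common (mem_tail hx hx' hs) (mem_tail hx' hx hs.symm)
  refine ⟨p, x, m, y, q, m', q', rfl, rfl, ?_, fun k hk hkc => ?_⟩
  · rintro rfl
    cases m with
    | nil => simp at hs
    | cons k m => exact hm' k (by simp) (by simp)
  · have hnodup := hc'.nodup
    simp only [List.mem_append, List.mem_cons] at hkc hm'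
    simp only [List.nodup_append, List.nodup_cons, List.mem_append, List.mem_cons] at hnodup
    grind

namespace IsDualCLLabeling

variable {α : Type*} [PartialOrder α] {u w x y : α} {ℓ : List α → List ℤ}
  {c c' r m m' t t' : List α}

theorem rootedLabels_congr (h : IsDualCLLabeling u w ℓ) (hr : IsMaximalChain y w r)
    (hm : IsMaximalChain x y m) (ht : IsMaximalChain u x t) (ht' : IsMaximalChain u x t') :
    rootedLabels ℓ r m t = rootedLabels ℓ r m t' := by
  have hrm := (hr.append hm).length_pos
  have htake := h.prefix_eq _ _ ((hr.append hm).append ht) ((hr.append hm).append ht')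
    ((r ++ m.tail).length - 1) (by rw [List.length_append (as := r ++ m.tail)]; omega)
    (by rw [Nat.sub_add_cancel hrm, List.take_left' rfl, List.take_left' rfl])
  have hlen : (r ++ m.tail).length - 1 = r.length - 1 + (m.length - 1) := by
    have := hr.length_pos
    simp only [List.length_append, List.length_tail]
    omega
  simpa only [rootedLabels, List.take_drop, hlen] using congrArg (List.drop (r.length - 1)) htake

theorem lt_of_rootedLabels_lt (h : IsDualCLLabeling u w ℓ) (hr : IsMaximalChain y w r)
    (hm : IsMaximalChain x y m) (hm' : IsMaximalChain x y m') (ht : IsMaximalChain u x t)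
    (ht' : IsMaximalChain u x t') (hlt : rootedLabels ℓ r m t < rootedLabels ℓ r m' t) :
    ℓ (r ++ m.tail ++ t.tail) < ℓ (r ++ m'.tail ++ t'.tail) := by
  have hlen : m.length - 1 = m'.length - 1 := by
    have := h.graded _ _ ((hr.append hm).append ht) ((hr.append hm').append ht)
    simpa using this
  rw [h.rootedLabels_congr hr hm' ht ht', rootedLabels, rootedLabels, hlen] at hlt
  have hpos := hr.length_pos
  refine list_lt_of_drop_lt_drop (h.prefix_eq _ _ ((hr.append hm).append ht)
    ((hr.append hm').append ht') (r.length - 1) (by simp only [List.length_append]; omega) ?_)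
    (list_lt_of_take_lt_take hlt)
  rw [Nat.sub_add_cancel hpos, List.append_assoc, List.append_assoc, List.take_left' rfl,
    List.take_left' rfl]

theorem exists_swap (h : IsDualCLLabeling u w ℓ) (hc : IsMaximalChain u w c) {k : ℕ}
    (hk : k + 1 < (ℓ c).length) (hdesc : (ℓ c)[k + 1] < (ℓ c)[k]) :
    ∃ f, IsMaximalChain u w (c.set (k + 1) f) ∧ ℓ (c.set (k + 1) f) < ℓ c := by
  have hlen := h.length_eq c hc
  obtain ⟨P, e, f, g, Q, rfl, rfl⟩ := exists_eq_append_cons_cons_cons (l := c) (k := k) (by omega)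
  obtain ⟨hr, hrest⟩ := IsMaximalChain.append_cons_iff.1 hc
  obtain ⟨hm, ht⟩ := (IsMaximalChain.append_cons_iff (p := [e, f]) (x := g)).1 hrest
  obtain ⟨m, hmax, hinc, huniq⟩ := h.rooted g e ht.le hm.le hr.le _ _ hr ht
  have hlabels : rootedLabels ℓ (P ++ [e]) [e, f, g] (g :: Q) =
      [(ℓ (P ++ e :: f :: g :: Q))[P.length], (ℓ (P ++ e :: f :: g :: Q))[P.length + 1]] := by
    simp only [rootedLabels, List.length_append, List.length_singleton, Nat.add_sub_cancel,
      List.tail_cons, List.append_assoc, List.cons_append, List.nil_append]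
    rw [List.drop_eq_getElem_cons (Nat.lt_of_succ_lt hk), List.drop_eq_getElem_cons hk]
    rfl
  have hne : [e, f, g] ≠ m := by
    rintro rfl
    simp [hlabels, hdesc.not_ge] at hinc
  have hlex := h.lt_of_rootedLabels_lt hr hmax hm ht ht (huniq _ hm hne).2
  have hcard := h.graded _ _ ((hr.append hmax).append ht) ((hr.append hm).append ht)
  obtain ⟨q, rfl⟩ := hmax.exists_cons
  obtain ⟨f', g', rfl⟩ := List.length_eq_two.1 (show q.length = 2 by simp at hcard; omega)
  obtain rfl : g' = g := by simpa using hmax.2.2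
  refine ⟨f', ?_, ?_⟩
  · simpa using (hr.append hmax).append ht
  · simpa using hlex

theorem exists_adjacent (h : IsDualCLLabeling u w ℓ) (hc : IsMaximalChain u w c)
    (hc' : IsMaximalChain u w c') (hne : c ≠ c') (hle : ℓ c ≤ ℓ c') :
    ∃ (i : ℕ) (hi : i < c'.length) (f : α), c'[i] ∉ c ∧
      IsMaximalChain u w (c'.set i f) ∧ ℓ (c'.set i f) < ℓ c' := by
  obtain ⟨p, x, m, y, q, m', q', rfl, rfl, hmm, hdisj⟩ := hc.exists_diverge hc' hne
  obtain ⟨hr, hrest⟩ := IsMaximalChain.append_cons_iff.1 hc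
  obtain ⟨-, hrest'⟩ := IsMaximalChain.append_cons_iff.1 hc'
  obtain ⟨hm, ht⟩ := (IsMaximalChain.append_cons_iff (p := x :: m) (x := y)).1 hrest
  obtain ⟨hm', ht'⟩ := (IsMaximalChain.append_cons_iff (p := x :: m') (x := y)).1 hrest'
  have hnot : ¬ (rootedLabels ℓ (p ++ [x]) (x :: m' ++ [y]) (y :: q')).Pairwise (· ≤ ·) := by
    intro hinc
    obtain ⟨m₀, -, -, huniq⟩ := h.rooted y x ht.le hm.le hr.le _ _ hr ht'
    obtain rfl : x :: m' ++ [y] = m₀ := by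
      by_contra hcon
      exact (huniq _ hm' hcon).1 hinc
    have := h.lt_of_rootedLabels_lt hr hm' hm ht' ht (huniq _ hm (by simpa using hmm)).2
    exact hle.not_gt (by simpa using this)
  obtain ⟨k, hk, hdesc⟩ := exists_getElem_lt_of_not_pairwise_le hnot
  obtain ⟨hkm, hkl⟩ : k < m'.length ∧
      p.length + k + 1 < (ℓ (p ++ x :: (m' ++ y :: q'))).length := by
    simp [rootedLabels] at hk
    omega
  have hinner : (p ++ x :: (m' ++ y :: q'))[p.length + k + 1]? = some m'[k] := by
    simp [List.getElem?_append, add_assoc, hkm]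
  obtain ⟨f, hmax, hlt⟩ := h.exists_swap hc' hkl (by
    simpa [rootedLabels, add_assoc] using hdesc)
  obtain ⟨hi, heq⟩ := List.getElem?_eq_some_iff.1 hinner
  exact ⟨p.length + k + 1, hi, f, heq ▸ hdisj _ (List.getElem_mem hkm), hmax, hlt⟩

theorem isShellable [LocallyFiniteOrder α] [DecidableEq α] (h : IsDualCLLabeling u w ℓ) :
    IsShellable (orderComplex u w) := by
  refine ⟨fun s t hs ht => ?_, ?_⟩
  · obtain ⟨c, hc, rfl⟩ := maximal_mem_orderComplex_iff.1 hs
    obtain ⟨c', hc', rfl⟩ := maximal_mem_orderComplex_iff.1 ht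
    rw [List.toFinset_card_of_nodup hc.nodup, List.toFinset_card_of_nodup hc'.nodup]
    exact h.graded c c' hc hc'
  obtain ⟨n, e, he, hmem⟩ : ∃ (n : ℕ) (e : Fin n → List α), Function.Injective e ∧
      ∀ c, IsMaximalChain u w c ↔ ∃ i, e i = c := by
    have := (finite_setOf_isMaximalChain u w).to_subtype
    obtain ⟨n, ⟨e⟩⟩ := Finite.exists_equiv_fin {c | IsMaximalChain u w c}
    refine ⟨n, fun i => (e.symm i).1, Subtype.val_injective.comp e.symm.injective, fun c => ?_⟩
    exact ⟨fun hc => ⟨e ⟨c, hc⟩, by simp⟩, by rintro ⟨i, rfl⟩; exact (e.symm i).2⟩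
  let F := e ∘ Tuple.sort (ℓ ∘ e)
  have hF : Function.Injective F := he.comp (Tuple.sort _).injective
  have hmono : Monotone (ℓ ∘ F) := Tuple.monotone_sort (ℓ ∘ e)
  have hmem : ∀ c, IsMaximalChain u w c ↔ ∃ i, F i = c := fun c => by
    rw [hmem, (Tuple.sort (ℓ ∘ e)).surjective.exists]; rfl
  have hmax : ∀ i, IsMaximalChain u w (F i) := fun i => (hmem _).2 ⟨i, rfl⟩
  refine ⟨n, fun i => (F i).toFinset, fun i j hij => hF ((hmax i).eq_of_toFinset_eq (hmax j) hij),
    fun s => ?_, fun i j hij => ?_⟩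
  · simp_rw [maximal_mem_orderComplex_iff, hmem, exists_exists_eq_and]
  · obtain ⟨l, hl, f, hfc, hswap, hlt⟩ := h.exists_adjacent (hmax i) (hmax j)
      (hF.ne hij.ne) (hmono hij.le)
    obtain ⟨k, hk⟩ := (hmem _).1 hswap
    have hinter : (F k).toFinset ∩ (F j).toFinset = (F j).toFinset.erase (F j)[l] := by
      have hf : f ≠ (F j)[l] := by
        rintro rfl
        simp at hlt
      rw [hk, toFinset_set_inter_toFinset (hmax j).nodup hl hf]
    refine ⟨k, lt_of_not_ge fun hjk => ?_, ?_, ?_⟩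
    · exact (hmono hjk).not_gt (by simpa [hk] using hlt)
    · simp only [hinter]
      intro z hz
      rw [Finset.mem_inter, List.mem_toFinset] at hz
      exact Finset.mem_erase.2 ⟨fun hzf => hfc (hzf ▸ hz.1), hz.2⟩
    · simp only [hinter]
      exact Finset.card_erase_add_one (List.mem_toFinset.2 (List.getElem_mem hl))

end IsDualCLLabeling

/-! ### The Möbius function of a poset with a dual CL-labeling -/

theorem sum_neg_one_pow_valley {β : Type*} [LinearOrder β] {l : List β} (hl : l ≠ []) :
    ∑ k ∈ Finset.range (l.length + 1),
      (if (l.take k).Pairwise (· > ·) ∧ (l.drop k).Pairwise (· ≤ ·) then (-1 : ℤ) ^ k else 0) =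
        0 := by
  induction l with
  | nil => exact absurd rfl hl
  | cons a l ih =>
    rw [Finset.sum_range_succ']
    cases l with
    | nil => simp
    | cons b l =>
      rcases lt_or_ge b a with hba | hab
      · have take_iff : ∀ k, ((a :: b :: l).take (k + 1)).Pairwise (· > ·) ↔
            ((b :: l).take k).Pairwise (· > ·) := by
          rintro (_ | k)
          · simp
          · simp only [List.take_succ_cons, List.pairwise_cons_cons_iff_of_trans, gt_iff_lt, hba,
              true_and]
        have not_increasing : ¬ (a :: b :: l).Pairwise (· ≤ ·) := by
          simp only [List.pairwise_cons_cons_iff_of_trans, hba.not_ge, false_and, not_false_iff]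
        simp only [take_iff, List.drop_succ_cons, List.drop_zero, not_increasing, and_false,
          if_false, add_zero]
        rw [← neg_eq_zero, ← Finset.sum_neg_distrib]
        refine (Finset.sum_congr rfl fun k _ => ?_).trans (ih (by simp))
        split_ifs <;> simp [pow_succ]
      · have not_decreasing : ∀ k, ¬ ((a :: b :: l).take (k + 1 + 1)).Pairwise (· > ·) := by
          simp [List.take_succ_cons, hab]
        have increasing_iff : (a :: b :: l).Pairwise (· ≤ ·) ↔ (b :: l).Pairwise (· ≤ ·) := by
          simp only [List.pairwise_cons_cons_iff_of_trans, hab, true_and]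
        rw [List.length_cons, Finset.sum_range_succ']
        simp only [not_decreasing, false_and, if_false, Finset.sum_const_zero, zero_add]
        simp only [List.take_succ_cons, List.take_zero, List.drop_succ_cons, List.drop_zero,
          increasing_iff, List.Pairwise.nil, true_and, List.pairwise_singleton]
        split_ifs <;> simp

/-- The label of an edge depends only on the part of the chain above it, even if chains to
different bottom elements are compared. -/
def IsTopDetermined {α : Type*} (ℓ : List α → List ℤ) : Prop :=
  ∀ r t : List α, r ≠ [] → (ℓ (r ++ t)).take (r.length - 1) = ℓ r

/-- The maximal chains of `[u, w]` with strictly decreasing labels. -/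
def descending {α : Type*} [PartialOrder α] (ℓ : List α → List ℤ) (u w : α) : Set (List α) :=
  {c | IsMaximalChain u w c ∧ (ℓ c).Pairwise (· > ·)}

section Valleys

variable {α : Type*} [PartialOrder α] {u w x : α} {ℓ : List α → List ℤ} {c r : List α}

theorem IsMaximalChain.exists_split {l : List α} (h : IsMaximalChain u w l) {k : ℕ}
    (hk : l[k]? = some x) :
    ∃ r m, IsMaximalChain x w r ∧ IsMaximalChain u x m ∧ l = r ++ m.tail ∧ r.length = k + 1 := by
  obtain ⟨hlt, rfl⟩ := List.getElem?_eq_some_iff.1 hk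
  have hl : l = l.take k ++ l[k] :: l.drop (k + 1) := by simp
  have hsplit := h
  rw [hl, IsMaximalChain.append_cons_iff] at hsplit
  exact ⟨_, _, hsplit.1, hsplit.2, by simp, by simpa using hlt⟩

namespace IsDualCLLabeling

theorem existsUnique_increasing (h : IsDualCLLabeling u w ℓ) (hux : u ≤ x)
    (hr : IsMaximalChain x w r) :
    ∃! m, IsMaximalChain u x m ∧
      ((ℓ (r ++ m.tail)).drop (r.length - 1)).Pairwise (· ≤ ·) := by
  have hu : IsMaximalChain u u [u] := IsMaximalChain.self_iff.2 rfl
  have hdrop : ∀ m, IsMaximalChain u x m →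
      rootedLabels ℓ r m [u] = (ℓ (r ++ m.tail)).drop (r.length - 1) := by
    intro m hm
    have hlen := h.length_eq _ (hr.append hm)
    have := hr.length_pos
    simp only [rootedLabels, List.tail_cons, List.append_nil]
    refine List.take_of_length_le ?_
    rw [List.length_drop, hlen, List.length_append, List.length_tail]
    omega
  obtain ⟨m, hm, hinc, huniq⟩ := h.rooted u x le_rfl hux hr.le _ _ hr hu
  refine ⟨m, ⟨hm, hdrop m hm ▸ hinc⟩, fun m' ⟨hm', hinc'⟩ => ?_⟩
  by_contra hne
  exact (huniq m' hm' hne).1 (hdrop m' hm' ▸ hinc')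

theorem descending_self (h : IsDualCLLabeling u u ℓ) : descending ℓ u u = {[u]} := by
  have hlen := h.length_eq [u] (IsMaximalChain.self_iff.2 rfl)
  ext c
  simp only [descending, Set.mem_ofPred_eq, IsMaximalChain.self_iff, Set.mem_singleton_iff,
    and_iff_left_iff_imp]
  rintro rfl
  rw [List.length_eq_zero_iff.1 hlen]
  exact List.Pairwise.nil

end IsDualCLLabeling

variable [LocallyFiniteOrder α]

open Classical in
/-- The maximal chains of `[u, w]` with a distinguished element, given by its index, such that the
labels are strictly decreasing above and weakly increasing below that element. -/
noncomputable def valleys (ℓ : List α → List ℤ) (u w : α) : Finset (Σ _ : List α, ℕ) :=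
  {p ∈ (finite_setOf_isMaximalChain u w).toFinset.sigma fun c => Finset.range c.length |
    ((ℓ p.1).take p.2).Pairwise (· > ·) ∧ ((ℓ p.1).drop p.2).Pairwise (· ≤ ·)}

theorem mem_valleys {k : ℕ} : ⟨c, k⟩ ∈ valleys ℓ u w ↔ (IsMaximalChain u w c ∧ k < c.length) ∧
    ((ℓ c).take k).Pairwise (· > ·) ∧ ((ℓ c).drop k).Pairwise (· ≤ ·) := by
  simp [valleys]

namespace IsDualCLLabeling

theorem sum_valleys (h : IsDualCLLabeling u w ℓ) (huw : u < w) :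
    ∑ p ∈ valleys ℓ u w, (-1 : ℤ) ^ p.2 = 0 := by
  rw [valleys, Finset.sum_filter, Finset.sum_sigma]
  refine Finset.sum_eq_zero fun c hc => ?_
  have hc : IsMaximalChain u w c := by simpa using hc
  have hlen : c.length = (ℓ c).length + 1 := by
    have := hc.length_pos
    have := h.length_eq c hc
    omega
  rw [hlen]
  refine sum_neg_one_pow_valley fun hnil => huw.ne ?_
  obtain ⟨z, rfl⟩ := List.length_eq_one_iff.1 (hlen.trans (by rw [hnil]; rfl))
  simpa [IsMaximalChain, eq_comm] using hc.2.1.symm.trans hc.2.2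

theorem card_valleys_fiber [DecidableEq α] (h : IsDualCLLabeling u w ℓ) (hℓ : IsTopDetermined ℓ)
    (hux : u ≤ x) :
    {p ∈ valleys ℓ u w | p.1[p.2]? = some x}.card = (descending ℓ x w).ncard := by
  have hnil : ∀ {r : List α}, IsMaximalChain x w r → r ≠ [] := fun hr =>
    List.ne_nil_of_length_pos hr.length_pos
  rw [← Set.ncard_coe_finset]
  refine Set.ncard_congr (fun p _ => p.1.take (p.2 + 1)) ?_ ?_ ?_
  · rintro ⟨c, k⟩ hp
    simp only [Finset.coe_filter, Set.mem_ofPred_eq, mem_valleys] at hp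
    obtain ⟨⟨⟨hc, -⟩, hdec, -⟩, hx⟩ := hp
    obtain ⟨r, m, hr, -, rfl, hk⟩ := hc.exists_split hx
    simp only [List.take_left' hk]
    refine ⟨hr, ?_⟩
    rwa [← hℓ r m.tail (hnil hr), hk]
  · rintro ⟨c, k⟩ ⟨c', k'⟩ hp hp' heq
    simp only [Finset.coe_filter, Set.mem_ofPred_eq, mem_valleys] at hp hp'
    obtain ⟨⟨⟨hc, -⟩, -, hinc⟩, hx⟩ := hp
    obtain ⟨⟨⟨hc', -⟩, -, hinc'⟩, hx'⟩ := hp'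
    obtain ⟨r, m, hr, hm, rfl, hk⟩ := hc.exists_split hx
    obtain ⟨r', m', hr', hm', rfl, hk'⟩ := hc'.exists_split hx'
    simp only [List.take_left' hk, List.take_left' hk'] at heq
    subst heq
    obtain rfl : k = k' := by omega
    obtain rfl : m = m' := (h.existsUnique_increasing hux hr).unique
      ⟨hm, by rwa [hk]⟩ ⟨hm', by rwa [hk]⟩
    rfl
  · rintro r ⟨hr, hdec⟩
    obtain ⟨m, ⟨hm, hinc⟩, -⟩ := h.existsUnique_increasing hux hr
    have hlen := hr.length_pos
    refine ⟨⟨r ++ m.tail, r.length - 1⟩, ?_, ?_⟩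
    · simp only [Finset.coe_filter, Set.mem_ofPred_eq, mem_valleys]
      refine ⟨⟨⟨hr.append hm, by rw [List.length_append]; omega⟩, ?_, hinc⟩, ?_⟩
      · rwa [hℓ r m.tail (hnil hr)]
      · rw [List.getElem?_append_left (by omega), ← List.getLast?_eq_getElem?, hr.2.2]
    · exact List.take_left' (Nat.sub_add_cancel hlen).symm

theorem sum_descending [GradeOrder ℕ α] (h : IsDualCLLabeling u w ℓ) (hℓ : IsTopDetermined ℓ)
    (huw : u < w) :
    ∑ x ∈ Finset.Icc u w, (-1 : ℤ) ^ (grade ℕ w + grade ℕ x) * (descending ℓ x w).ncard = 0 := by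
  classical
  have mem_Icc_of_mem_valleys : ∀ p ∈ valleys ℓ u w,
      p.1[p.2]? ∈ (Finset.Icc u w).map Function.Embedding.some := by
    rintro ⟨c, k⟩ hp
    obtain ⟨⟨hc, hk⟩, -⟩ := mem_valleys.1 hp
    rw [List.getElem?_eq_getElem hk]
    exact Finset.mem_map_of_mem _ (Finset.mem_Icc.2 (hc.mem_Icc (List.getElem_mem hk)))
  rw [← h.sum_valleys huw, ← Finset.sum_fiberwise_of_maps_to mem_Icc_of_mem_valleys,
    Finset.sum_map]
  refine Finset.sum_congr rfl fun x hx => ?_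
  have hsign : ∀ p ∈ {p ∈ valleys ℓ u w | p.1[p.2]? = some x},
      (-1 : ℤ) ^ p.2 = (-1) ^ (grade ℕ w + grade ℕ x) := by
    rintro ⟨c, k⟩ hp
    obtain ⟨hmem, hx⟩ := Finset.mem_filter.1 hp
    obtain ⟨r, m, hr, -, -, hk⟩ := (mem_valleys.1 hmem).1.1.exists_split hx
    have := hr.grade_add_one
    dsimp only at hk ⊢
    rw [show grade ℕ w + grade ℕ x = k + 2 * grade ℕ x by omega, pow_add, pow_mul, neg_one_sq,
      one_pow, mul_one]
  simp only [Function.Embedding.some_apply]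
  rw [Finset.sum_congr rfl hsign, Finset.sum_const, nsmul_eq_mul, mul_comm,
    h.card_valleys_fiber hℓ (Finset.mem_Icc.1 hx).1]

end IsDualCLLabeling

theorem mu_eq_ncard_descending [DecidableEq α] [GradeOrder ℕ α]
    (h : ∀ u w : α, u ≤ w → IsDualCLLabeling u w ℓ) (hℓ : IsTopDetermined ℓ) (u w : α) :
    IncidenceAlgebra.mu ℤ u w =
      (-1) ^ (grade ℕ w + grade ℕ u) * ((descending ℓ u w).ncard : ℤ) := by
  by_cases huw : u ≤ w
  · induction hn : (Finset.Icc u w).card using Nat.strong_induction_on generalizing u with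
    | _ n ih =>
    rcases huw.eq_or_lt with rfl | hlt
    · simp [(h u u le_rfl).descending_self, ← two_mul]
    · have hmu := IncidenceAlgebra.sum_Icc_mu_left (𝕜 := ℤ) u w
      rw [if_neg hlt.ne, ← (h u w huw).sum_descending hℓ hlt, Finset.Icc_eq_cons_Ioc huw,
        Finset.sum_cons, Finset.sum_cons] at hmu
      refine add_right_cancel (hmu.trans (congrArg _ (Finset.sum_congr rfl fun x hx => ?_)))
      rw [Finset.mem_Ioc] at hx
      refine (ih _ ?_ x hx.2 rfl).symm
      exact hn ▸ Finset.card_lt_card (Finset.Icc_ssubset_Icc_left huw hx.1 le_rfl)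
  · have hempty : descending ℓ u w = ∅ :=
      Set.eq_empty_of_forall_notMem fun c hc => huw hc.1.le
    simp [IncidenceAlgebra.apply_eq_zero_of_not_le huw, hempty]

end Valleys

/-! ### Subwords and positions -/

theorem sort_toFinset_of_sortedLT {l : List ℕ} (h : l.SortedLT) : l.toFinset.sort = l :=
  (List.toFinset_sort (r := (· ≤ ·)) h.nodup).2 h.sortedLE.pairwise

namespace Word

variable {w x : Word} {S T : Finset ℕ} {d p q r : ℕ}

theorem letterAt_mem_zipIdx {p : Letter × ℕ} (hp : p ∈ w.letters.zipIdx 1) :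
    w.letterAt p.2 = some p.1 ∧ p.2 ∈ Finset.Icc 1 w.length := by
  obtain ⟨c, i⟩ := p
  obtain ⟨h1, h2⟩ := List.mk_mem_zipIdx_iff_le_and_getElem?_sub.1 hp
  obtain ⟨j, rfl⟩ := Nat.exists_eq_add_of_le' h1
  have hj := (List.getElem?_eq_some_iff.1 h2).1
  simp only [Nat.add_sub_cancel] at h2 hj
  exact ⟨h2, Finset.mem_Icc.2 ⟨h1, hj⟩⟩

theorem exists_mem_zipIdx {i : ℕ} (hi : i ∈ Finset.Icc 1 w.length) :
    ∃ c, (c, i) ∈ w.letters.zipIdx 1 := by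
  simp only [Finset.mem_Icc, length] at hi
  refine ⟨w.letters[i - 1]'(by omega), ?_⟩
  rw [List.mk_mem_zipIdx_iff_le_and_getElem?_sub]
  exact ⟨hi.1, List.getElem?_eq_getElem _⟩

theorem map_some_letters_restrict (hS : S ⊆ Finset.Icc 1 w.length) :
    (w.restrict S).letters.map some = S.sort.map w.letterAt := by
  set L := (w.letters.zipIdx 1).filter (fun p => p.2 ∈ S) with hL
  have hsorted : (L.map Prod.snd).SortedLT := by
    rw [List.sortedLT_iff_pairwise]
    refine List.Pairwise.sublist (List.filter_sublist.map _) ?_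
    rw [List.zipIdx_map_snd, List.pairwise_iff_getElem]
    intro i j hi hj hij
    simpa using hij
  have hset : (L.map Prod.snd).toFinset = S := by
    ext i
    simp only [List.mem_toFinset, List.mem_map, hL, List.mem_filter, decide_eq_true_eq]
    constructor
    · rintro ⟨p, ⟨_, h⟩, rfl⟩
      exact h
    · intro hi
      obtain ⟨c, hc⟩ := exists_mem_zipIdx (hS hi)
      exact ⟨_, ⟨hc, hi⟩, rfl⟩
  rw [← hset, sort_toFinset_of_sortedLT hsorted, hset]
  simp only [restrict, List.map_map, ← hL]
  exact List.map_congr_left fun p hp => (letterAt_mem_zipIdx (List.mem_filter.1 hp).1).1.symm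

theorem restrict_eq_iff (hS : S ⊆ Finset.Icc 1 w.length) :
    w.restrict S = x ↔ x.letters.map some = S.sort.map w.letterAt := by
  rw [← map_some_letters_restrict hS, (Option.some_injective Letter).list_map.eq_iff, Word.ext_iff,
    eq_comm]

theorem length_restrict (hS : S ⊆ Finset.Icc 1 w.length) : (w.restrict S).length = S.card := by
  simpa [length] using congrArg List.length (map_some_letters_restrict hS)

theorem restrict_full (w : Word) : w.restrict (Finset.Icc 1 w.length) = w := by
  ext1
  simp only [restrict]
  rw [List.filter_eq_self.2, List.zipIdx_map_fst]
  exact fun p hp => decide_eq_true (letterAt_mem_zipIdx hp).2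

theorem restrict_mono (w : Word) (h : T ⊆ S) : w.restrict T ≤ w.restrict S := by
  refine List.Sublist.map _ (List.monotone_filter_right _ fun p hp => ?_)
  simp only [decide_eq_true_eq] at hp ⊢
  exact h hp

theorem exists_restrict_eq_of_le (hS : S ⊆ Finset.Icc 1 w.length) (h : x ≤ w.restrict S) :
    ∃ T ⊆ S, w.restrict T = x := by
  have h1 : (x.letters.map some).Sublist (S.sort.map w.letterAt) := by
    rw [← map_some_letters_restrict hS]
    exact List.Sublist.map _ h
  obtain ⟨l, hl, he⟩ := List.sublist_map_iff.1 h1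
  have hlt : l.SortedLT := ((Finset.sortedLT_sort S).pairwise.sublist hl).sortedLT
  have hT : l.toFinset ⊆ S := fun i hi => by
    simpa using hl.subset (List.mem_toFinset.1 hi)
  refine ⟨l.toFinset, hT, ?_⟩
  rw [restrict_eq_iff (hT.trans hS), sort_toFinset_of_sortedLT hlt, he]

theorem restrict_image (hT : T ⊆ Finset.Icc 1 w.length) {f : ℕ → ℕ}
    (himage : T.image f ⊆ Finset.Icc 1 w.length) (hf : StrictMonoOn f T)
    (hletter : ∀ i ∈ T, w.letterAt (f i) = w.letterAt i) :
    w.restrict (T.image f) = w.restrict T := by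
  have hsorted : (T.sort.map f).SortedLT := by
    rw [List.sortedLT_iff_pairwise, List.pairwise_map]
    refine (Finset.sortedLT_sort T).pairwise.imp_of_mem fun hi hj hij => ?_
    exact hf (Finset.mem_sort _ |>.1 hi) (Finset.mem_sort _ |>.1 hj) hij
  have hsort : (T.image f).sort = T.sort.map f := by
    rw [← sort_toFinset_of_sortedLT hsorted]
    congr 1
    ext i
    simp only [Finset.mem_image, List.mem_toFinset, List.mem_map, Finset.mem_sort]
  rw [restrict_eq_iff himage, map_some_letters_restrict hT, hsort, List.map_map]
  exact List.map_congr_left fun i hi => (hletter i (Finset.mem_sort _ |>.1 hi)).symm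

theorem restrict_swap (hT : T ⊆ Finset.Icc 1 w.length) {t i : ℕ} (ht : t ∈ T)
    (hi : i ∈ Finset.Icc 1 w.length) (hti : t < i)
    (hgap : ∀ k ∈ T, t < k → i < k) (hw : w.letterAt t = w.letterAt i) :
    w.restrict (insert i (T.erase t)) = w.restrict T := by
  have himage : insert i (T.erase t) = T.image (Function.update id t i) := by
    ext k
    simp only [Finset.mem_insert, Finset.mem_erase, Finset.mem_image, Function.update_apply, id_eq]
    grind
  rw [himage]
  refine restrict_image hT ?_ ?_ ?_
  · rw [← himage]
    exact Finset.insert_subset hi ((Finset.erase_subset _ _).trans hT)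
  · intro j hj k hk hjk
    simp only [Function.update_apply, id_eq]
    have := hgap j hj
    have := hgap k hk
    grind
  · intro j _
    simp only [Function.update_apply, id_eq]
    grind

/-- The number of elements of `T` up to `p`. For `p ∈ T` the letter of `w` at `p` is the letter of
`w.restrict T` at position `rank T p`. -/
def rank (T : Finset ℕ) (p : ℕ) : ℕ := (T.filter (· ≤ p)).card

theorem rank_eq_count (T : Finset ℕ) (p : ℕ) : rank T p = Nat.count (· ∈ T) (p + 1) := by
  rw [Nat.count_eq_card_filter_range]
  refine congrArg Finset.card (Finset.ext fun i => ?_)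
  simp only [Finset.mem_filter, Finset.mem_range, Nat.lt_succ_iff]
  exact and_comm

theorem rank_mono (T : Finset ℕ) : Monotone (rank T) := fun _ _ h => by
  simpa only [rank_eq_count] using Nat.count_monotone (· ∈ T) (Nat.succ_le_succ h)

theorem rank_eq_count_add_one (hp : p ∈ T) : rank T p = Nat.count (· ∈ T) p + 1 := by
  rw [rank_eq_count, Nat.count_succ, if_pos hp]

theorem rank_lt_rank (hq : q ∈ T) (hpq : p < q) : rank T p < rank T q := by
  rw [rank_eq_count_add_one hq, rank_eq_count]
  exact Nat.lt_succ_of_le (Nat.count_monotone _ hpq)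

theorem le_of_rank_le (hp : p ∈ T) (h : rank T p ≤ rank T q) : p ≤ q :=
  not_lt.1 fun hlt => (rank_lt_rank hp hlt).not_ge h

theorem exists_rank_eq (h1 : 1 ≤ r) (h2 : r ≤ T.card) : ∃ p ∈ T, rank T p = r := by
  have hlt (hfin : (Set.ofPred (· ∈ T)).Finite) : r - 1 < hfin.toFinset.card := by
    rw [show hfin.toFinset = T from Finset.ext fun i => hfin.mem_toFinset]
    omega
  refine ⟨Nat.nth (· ∈ T) (r - 1), Nat.nth_mem _ hlt, ?_⟩
  rw [rank_eq_count, Nat.count_nth_succ hlt]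
  omega

theorem rank_injective : Function.Injective rank := fun S T h => by
  ext i
  have hcount (j : ℕ) : Nat.count (· ∈ S) (j + 1) = Nat.count (· ∈ T) (j + 1) := by
    simpa only [rank_eq_count] using congrFun h j
  have hi := hcount i
  have hlt : Nat.count (· ∈ S) i = Nat.count (· ∈ T) i := by
    cases i with
    | zero => simp
    | succ j => exact hcount j
  rw [Nat.count_succ, Nat.count_succ, hlt] at hi
  grind

theorem card_inter_Icc_add_rank (hp : p ∈ T) (hpq : p ≤ q) :
    (T ∩ Finset.Icc p q).card + rank T p = rank T q + 1 := by
  have hdisj : Disjoint (T ∩ Finset.Icc p q) (T.filter (· < p)) :=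
    Finset.disjoint_left.2 fun i hi hi' => by
      simp only [Finset.mem_inter, Finset.mem_Icc, Finset.mem_filter] at hi hi'
      omega
  have hunion : T.filter (· ≤ q) = (T ∩ Finset.Icc p q) ∪ T.filter (· < p) := by
    ext i
    simp only [Finset.mem_union, Finset.mem_inter, Finset.mem_Icc, Finset.mem_filter]
    grind
  have hsucc : T.filter (· ≤ p) = insert p (T.filter (· < p)) := by
    ext i
    simp only [Finset.mem_insert, Finset.mem_filter]
    grind
  rw [rank, rank, hunion, Finset.card_union_of_disjoint hdisj, hsucc,
    Finset.card_insert_of_notMem (by simp)]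
  omega

theorem le_of_card_inter_Icc_pos (h : 0 < (T ∩ Finset.Icc p q).card) : p ≤ q := by
  obtain ⟨i, hi⟩ := Finset.card_pos.1 h
  exact Finset.nonempty_Icc.1 ⟨i, Finset.mem_of_mem_inter_right hi⟩

theorem rank_mem_Icc (hp : p ∈ T) : rank T p ∈ Finset.Icc 1 T.card :=
  Finset.mem_Icc.2 ⟨Finset.card_pos.2 ⟨p, by simpa using hp⟩, Finset.card_filter_le _ _⟩

theorem letterAt_restrict (hT : T ⊆ Finset.Icc 1 w.length) (hp : p ∈ T) :
    (w.restrict T).letterAt (rank T p) = w.letterAt p := by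
  have hfin : (Set.ofPred (· ∈ T)).Finite := T.finite_toSet
  have htoFinset : hfin.toFinset = T := Finset.ext fun i => hfin.mem_toFinset
  set k := Nat.count (· ∈ T) p
  have hrank : rank T p = k + 1 := rank_eq_count_add_one hp
  have hsort : T.sort[k]? = some p := by
    have hlt : k < T.sort.length := by
      rw [Finset.length_sort]
      have := (Finset.mem_Icc.1 (rank_mem_Icc hp)).2
      omega
    have hnth : Nat.nth (· ∈ T) k = p := Nat.nth_count hp
    rw [Nat.nth_eq_getD_sort hfin, htoFinset, List.getD_eq_getElem _ _ hlt] at hnth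
    rw [List.getElem?_eq_getElem hlt, hnth]
  have hmap := congrArg (fun l => l[k]?) (map_some_letters_restrict hT)
  simp only [List.getElem?_map, hsort, Option.map_some, Option.map_eq_some_iff] at hmap
  obtain ⟨c, hc, hcp⟩ := hmap
  rw [hrank, ← hcp]
  exact hc

theorem mem_Icc_of_letterAt_eq_some {c : Letter} (h : w.letterAt r = some c) :
    r ∈ Finset.Icc 1 w.length := by
  cases r with
  | zero => simp [letterAt] at h
  | succ r => exact Finset.mem_Icc.2 ⟨Nat.succ_pos r, (List.getElem?_eq_some_iff.1 h).1⟩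

theorem letterAt_restrict_eq_some_iff (hT : T ⊆ Finset.Icc 1 w.length) {c : Letter} :
    (w.restrict T).letterAt r = some c ↔ ∃ p ∈ T, rank T p = r ∧ w.letterAt p = some c := by
  constructor
  · intro h
    have hr := mem_Icc_of_letterAt_eq_some h
    rw [length_restrict hT, Finset.mem_Icc] at hr
    obtain ⟨p, hp, rfl⟩ := exists_rank_eq hr.1 hr.2
    exact ⟨p, hp, rfl, letterAt_restrict hT hp ▸ h⟩
  · rintro ⟨p, hp, rfl, hc⟩
    rw [letterAt_restrict hT hp, hc]

/-! ### Runs of the letter `b` in a subword -/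

/-- All positions of `T` from `p` to `q` carry the letter `b`, so that they form a part of a run of
`w.restrict T`. -/
def IsBBlock (w : Word) (T : Finset ℕ) (p q : ℕ) : Prop :=
  ∀ i ∈ T, p ≤ i → i ≤ q → w.letterAt i = some Letter.b

theorem bRunAt_restrict_rank_iff (hT : T ⊆ Finset.Icc 1 w.length) (hp : p ∈ T) :
    BRunAt d (w.restrict T) (rank T p) ↔
      w.letterAt p = some Letter.b ∧ ∃ q, IsBBlock w T p q ∧ d ≤ (T ∩ Finset.Icc p q).card := by
  rw [BRunAt, letterAt_restrict hT hp]
  refine and_congr_right fun hpb => ⟨fun hrun => ?_, ?_⟩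
  · rcases Nat.eq_zero_or_pos d with rfl | hd
    · exact ⟨p, fun i _ h1 h2 => le_antisymm h2 h1 ▸ hpb, Nat.zero_le _⟩
    obtain ⟨q, -, hrank, -⟩ := (letterAt_restrict_eq_some_iff hT).1 (hrun (d - 1) (by omega))
    refine ⟨q, fun i hi hpi hiq => ?_, ?_⟩
    · have h1 := rank_mono T hpi
      have h2 := rank_mono T hiq
      rw [← letterAt_restrict hT hi, ← hrun (rank T i - rank T p) (by omega)]
      congr 1
      omega
    · have := card_inter_Icc_add_rank hp (le_of_rank_le hp (by omega : rank T p ≤ rank T q))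
      omega
  · rintro ⟨q, hblock, hcard⟩ t ht
    have hpq : p ≤ q := le_of_card_inter_Icc_pos (t.zero_le.trans_lt (ht.trans_le hcard))
    have h1 := card_inter_Icc_add_rank hp hpq
    have h2 : rank T q ≤ T.card := Finset.card_filter_le _ _
    obtain ⟨i, hi, hrank⟩ := exists_rank_eq (T := T) (r := rank T p + t)
      (by have := (Finset.mem_Icc.1 (rank_mem_Icc hp)).1; omega) (by omega)
    rw [← hrank, letterAt_restrict hT hi]
    exact hblock i hi (le_of_rank_le hp (by omega)) (le_of_rank_le hi (by omega))

theorem runsLE_iff : RunsLE d w ↔ ∀ r, ¬ BRunAt (d + 1) w r := by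
  rw [RunsLE, ← not_exists, not_iff_not, List.infix_iff_getElem?]
  simp only [BRunAt, List.length_replicate, List.getElem_replicate]
  constructor
  · rintro ⟨k, hk⟩
    have hrun (t : ℕ) (ht : t < d + 1) : w.letterAt (k + 1 + t) = some Letter.b := by
      rw [Nat.add_right_comm]
      simpa only [letterAt, Nat.add_comm t k] using hk.2 t ht
    exact ⟨k + 1, hrun 0 d.succ_pos, hrun⟩
  · rintro ⟨r, hr, hrun⟩
    have hr1 := (Finset.mem_Icc.1 (mem_Icc_of_letterAt_eq_some hr)).1
    obtain ⟨k, rfl⟩ := Nat.exists_eq_add_of_le' hr1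
    have hk (t : ℕ) (ht : t < d + 1) : w.letters[t + k]? = some Letter.b := by
      have := hrun t ht
      rwa [Nat.add_right_comm, Nat.add_comm k t] at this
    exact ⟨k, by have := (List.getElem?_eq_some_iff.1 (hk d d.lt_succ_self)).1; omega, hk⟩

theorem runsLE_restrict_iff (hT : T ⊆ Finset.Icc 1 w.length) :
    RunsLE d (w.restrict T) ↔
      ∀ p ∈ T, ∀ q, IsBBlock w T p q → (T ∩ Finset.Icc p q).card ≤ d := by
  rw [runsLE_iff]
  constructor
  · intro h p hp q hblock
    by_contra! hcard
    have hpq : p ≤ q := le_of_card_inter_Icc_pos (d.succ_pos.trans_le hcard)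
    exact h _ ((bRunAt_restrict_rank_iff hT hp).2 ⟨hblock p hp le_rfl hpq, q, hblock, hcard⟩)
  · intro h r hr
    obtain ⟨p, hp, rfl, -⟩ := (letterAt_restrict_eq_some_iff hT).1 hr.1
    obtain ⟨-, q, hblock, hcard⟩ := (bRunAt_restrict_rank_iff hT hp).1 hr
    exact (h p hp q hblock).not_gt hcard

end Word

/-! ### Rightmost embeddings and deletion sequences -/

namespace Word

variable {d : ℕ} {w x : Word} {S T U : Finset ℕ} {i j p q : ℕ}

/-- `i` is not preceded in `T` by the same letter of `w`. -/
def StartsRun (w : Word) (T : Finset ℕ) (i : ℕ) : Prop :=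
  ∀ t, IsGreatest {k | k ∈ T ∧ k < i} t → w.letterAt t ≠ w.letterAt i

/-- `i ∈ S` is the first letter of a run of the subword of `w` at the positions `S`. -/
def IsRunHead (w : Word) (S : Finset ℕ) (i : ℕ) : Prop :=
  i ∈ S ∧ StartsRun w S i

/-- `T` is a rightmost embedding among those contained in `S`: no letter can be moved to the
right inside its gap. -/
def IsRightmost (w : Word) (S T : Finset ℕ) : Prop :=
  ∀ i ∈ S, i ∉ T → StartsRun w T i

theorem exists_isGreatest_lt (hj : j ∈ T) (hji : j < i) :
    ∃ t, IsGreatest {k | k ∈ T ∧ k < i} t := by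
  have hne : (T.filter (· < i)).Nonempty := ⟨j, Finset.mem_filter.2 ⟨hj, hji⟩⟩
  refine ⟨(T.filter (· < i)).max' hne, ?_⟩
  simpa only [Finset.coe_filter] using Finset.isGreatest_max' _ hne

theorem startsRun_congr (h : ∀ k < i, k ∈ S ↔ k ∈ T) : StartsRun w S i ↔ StartsRun w T i := by
  have hset : {k | k ∈ S ∧ k < i} = {k | k ∈ T ∧ k < i} :=
    Set.ext fun k => and_congr_left fun hk => h k hk
  rw [StartsRun, StartsRun, hset]

theorem exists_isRightmost (hS : S ⊆ Finset.Icc 1 w.length) (h : x ≤ w.restrict S) :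
    ∃ T ⊆ S, w.restrict T = x ∧ IsRightmost w S T := by
  obtain ⟨T₀, hT₀, hx₀⟩ := exists_restrict_eq_of_le hS h
  obtain ⟨T, hT, hmax⟩ := Finset.exists_max_image (S.powerset.filter fun T => w.restrict T = x)
    (fun T => ∑ i ∈ T, i) ⟨T₀, by simp [hT₀, hx₀]⟩
  simp only [Finset.mem_filter, Finset.mem_powerset, and_imp] at hT hmax
  refine ⟨T, hT.1, hT.2, fun i hi hiT t ⟨⟨ht, hti⟩, hpred⟩ heq => ?_⟩
  have hgap (k : ℕ) (hk : k ∈ T) (htk : t < k) : i < k := by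
    have hki : k ≠ i := fun h => hiT (h ▸ hk)
    have := mt (fun h => hpred ⟨hk, h⟩) htk.not_ge
    omega
  have hsum := hmax _ (Finset.insert_subset hi ((Finset.erase_subset t T).trans hT.1))
    (by rw [restrict_swap (hT.1.trans hS) ht (hS hi) hti hgap heq, hT.2])
  rw [Finset.sum_insert (fun h => hiT (Finset.mem_of_mem_erase h)),
    ← Finset.add_sum_erase _ _ ht] at hsum
  omega

theorem card_eq_of_restrict_eq (hS : S ⊆ Finset.Icc 1 w.length) (hT : T ⊆ Finset.Icc 1 w.length)
    (heq : w.restrict S = w.restrict T) : S.card = T.card := by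
  rw [← length_restrict hS, ← length_restrict hT, heq]

theorem IsRightmost.le_of_rank_eq (hS : S ⊆ Finset.Icc 1 w.length) (hT : T ⊆ S)
    (h : IsRightmost w S T) (hU : U ⊆ S) (heq : w.restrict U = w.restrict T)
    (hq : q ∈ T) (hp : p ∈ U) (hrank : rank U p = rank T q) : p ≤ q := by
  have hcard := card_eq_of_restrict_eq (hU.trans hS) (hT.trans hS) heq
  by_contra! hlt
  have hfin : {q | q ∈ T ∧ ∃ p ∈ U, rank U p = rank T q ∧ q < p}.Finite :=
    T.finite_toSet.subset fun _ hq => hq.1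
  obtain ⟨q, ⟨hq, p, hp, hrank, hlt⟩, hmax⟩ := hfin.exists_maximal ⟨q, hq, p, hp, hrank, hlt⟩
  have hgap (k : ℕ) (hk : k ∈ T) (hkp : k ≤ p) : k ≤ q := by
    by_contra! hqk
    obtain ⟨h1, h2⟩ := Finset.mem_Icc.1 (rank_mem_Icc hk)
    obtain ⟨p', hp', hrank'⟩ := exists_rank_eq (T := U) h1 (hcard ▸ h2)
    have hqk' := rank_lt_rank hk hqk
    have hpp' : p < p' := by
      by_contra! hle
      have := rank_mono U hle
      omega
    exact (hmax ⟨hk, p', hp', hrank', hkp.trans_lt hpp'⟩ hqk.le).not_gt hqk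
  have hpT : p ∉ T := fun hpT => (hgap p hpT le_rfl).not_gt hlt
  refine h p (hU hp) hpT q ⟨⟨hq, hlt⟩, fun k hk => hgap k hk.1 hk.2.le⟩ ?_
  rw [← letterAt_restrict (hT.trans hS) hq, ← letterAt_restrict (hU.trans hS) hp, heq, hrank]

theorem IsRightmost.rank_le (hS : S ⊆ Finset.Icc 1 w.length) (hT : T ⊆ S)
    (h : IsRightmost w S T) (hU : U ⊆ S) (heq : w.restrict U = w.restrict T) (m : ℕ) :
    rank T m ≤ rank U m := by
  rcases Nat.eq_zero_or_pos (rank T m) with h0 | hpos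
  · omega
  have hm : rank T m ≤ T.card := Finset.card_filter_le _ _
  obtain ⟨q, hq, hqm⟩ := exists_rank_eq hpos hm
  obtain ⟨p, hp, hpm⟩ := exists_rank_eq (T := U) hpos
    (card_eq_of_restrict_eq (hU.trans hS) (hT.trans hS) heq ▸ hm)
  have hpq := h.le_of_rank_eq hS hT hU heq hq hp (hpm.trans hqm.symm)
  exact hpm ▸ rank_mono U (hpq.trans (le_of_rank_le hq hqm.le))

theorem IsRightmost.unique (hS : S ⊆ Finset.Icc 1 w.length) (hT : T ⊆ S)
    (h : IsRightmost w S T) (hU : U ⊆ S) (h' : IsRightmost w S U)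
    (heq : w.restrict U = w.restrict T) : U = T :=
  rank_injective <| funext fun m =>
    (h'.rank_le hS hU hT heq.symm m).antisymm (h.rank_le hS hT hU heq m)

theorem IsRightmost.runsLE_erase (hS : S ⊆ Finset.Icc 1 w.length) (hT : T ⊆ S)
    (h : IsRightmost w S T) (hdS : RunsLE d (w.restrict S)) (hdT : RunsLE d (w.restrict T))
    (hiT : i ∉ T) (hmin : ∀ j ∈ S, j < i → j ∈ T) :
    RunsLE d (w.restrict (S.erase i)) := by
  rw [runsLE_restrict_iff ((Finset.erase_subset _ _).trans hS)]
  intro p hp q hblock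
  obtain ⟨hpi, hpS⟩ := Finset.mem_erase.1 hp
  by_cases hi : p < i ∧ i ≤ q
  · have hpT := hmin p hpS hi.1
    have hTS : T ⊆ S.erase i := fun t ht => Finset.mem_erase.2 ⟨fun e => hiT (e ▸ ht), hT ht⟩
    refine le_trans (Finset.card_le_card fun k hk => ?_)
      ((runsLE_restrict_iff (hT.trans hS)).1 hdT p hpT q fun k hk => hblock k (hTS hk))
    rw [Finset.mem_inter, Finset.mem_Icc] at hk ⊢
    obtain ⟨hk, hpk, hkq⟩ := hk
    refine ⟨by_contra fun hkT => ?_, hpk, hkq⟩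
    have hpk' : p < k := hpk.lt_of_ne fun e => hkT (e ▸ hpT)
    obtain ⟨t, ht⟩ := exists_isGreatest_lt hpT hpk'
    refine h k (Finset.mem_of_mem_erase hk) hkT t ht ?_
    rw [hblock k hk hpk hkq,
      hblock t (hTS ht.1.1) (ht.2 ⟨hpT, hpk'⟩) (ht.1.2.le.trans hkq)]
  · refine (Finset.card_le_card (Finset.inter_subset_inter_right (Finset.erase_subset i S))).trans
      ((runsLE_restrict_iff hS).1 hdS p hpS q fun k hk hpk hkq => ?_)
    exact hblock k (Finset.mem_erase.2 ⟨by rintro rfl; omega, hk⟩) hpk hkq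

/-- `l` lists positions that can be deleted one after the other from the subword of `w` at the
positions `S`, each being the head of a run when it is deleted, so that all words
obtained on the way lie in `A*_d`. -/
def IsDeletion (d : ℕ) (w : Word) : Finset ℕ → List ℕ → Prop
  | _, [] => True
  | S, i :: l => IsRunHead w S i ∧ RunsLE d (w.restrict (S.erase i)) ∧ IsDeletion d w (S.erase i) l

theorem sdiff_toFinset_cons (S : Finset ℕ) (i : ℕ) (l : List ℕ) :
    S \ (i :: l).toFinset = S.erase i \ l.toFinset := by
  rw [List.toFinset_cons, Finset.sdiff_insert, Finset.erase_sdiff_comm]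

theorem mem_sdiff_toFinset_cons_of_lt {l : List ℕ} (hl : (i :: l).Pairwise (· ≤ ·)) (hj : j ∈ S)
    (hji : j < i) : j ∈ S \ (i :: l).toFinset := by
  refine Finset.mem_sdiff.2 ⟨hj, fun hjl => hji.not_ge ?_⟩
  rcases List.mem_cons.1 (List.mem_toFinset.1 hjl) with rfl | hjl
  · exact le_rfl
  · exact List.rel_of_pairwise_cons hl hjl

theorem IsRightmost.le_of_notMem (hS : S ⊆ Finset.Icc 1 w.length) (hT : T ⊆ S)
    (h : IsRightmost w S T) (hmin : ∀ j ∈ S, j < i → j ∈ T) (hU : U ⊆ S)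
    (heq : w.restrict U = w.restrict T) (hj : j ∈ S) (hjU : j ∉ U) : i ≤ j := by
  by_contra! hlt
  refine (h.rank_le hS hT hU heq j).not_gt (Finset.card_lt_card
    ((Finset.ssubset_iff_of_subset fun k hk => ?_).2 ⟨j, ?_, fun h => ?_⟩))
  · rw [Finset.mem_filter] at hk ⊢
    exact ⟨hmin k (hU hk.1) (hk.2.trans_lt hlt), hk.2⟩
  · exact Finset.mem_filter.2 ⟨hmin j hj hlt, le_rfl⟩
  · exact hjU (Finset.mem_filter.1 h).1

theorem IsRightmost.isDeletion {l : List ℕ} (hS : S ⊆ Finset.Icc 1 w.length) (hlS : l.toFinset ⊆ S)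
    (hl : l.Pairwise (· < ·)) (h : IsRightmost w S (S \ l.toFinset))
    (hdS : RunsLE d (w.restrict S)) (hdT : RunsLE d (w.restrict (S \ l.toFinset))) :
    IsDeletion d w S l := by
  induction l generalizing S with
  | nil => trivial
  | cons i l ih =>
    have hi : i ∈ S := hlS (by simp)
    have hmin (j : ℕ) (hj : j ∈ S) (hji : j < i) :=
      mem_sdiff_toFinset_cons_of_lt (hl.imp le_of_lt) hj hji
    have hiT : i ∉ S \ (i :: l).toFinset := by simp
    have hd := h.runsLE_erase hS Finset.sdiff_subset hdS hdT hiT hmin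
    refine ⟨⟨hi, (startsRun_congr fun k hk => ?_).1 (h i hi hiT)⟩, hd, ?_⟩
    · exact ⟨fun hkT => (Finset.mem_sdiff.1 hkT).1, fun hkS => hmin k hkS hk⟩
    · rw [sdiff_toFinset_cons] at h hdT
      refine ih ((Finset.erase_subset _ _).trans hS) (fun j hj => ?_) hl.of_cons
        (fun j hj => h j (Finset.mem_of_mem_erase hj)) hd hdT
      rw [List.mem_toFinset] at hj
      exact Finset.mem_erase.2 ⟨(List.rel_of_pairwise_cons hl hj).ne', hlS (by simp [hj])⟩

theorem exists_increasing_isDeletion (hS : S ⊆ Finset.Icc 1 w.length)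
    (hdS : RunsLE d (w.restrict S)) (h : x ≤ w.restrict S) (hdx : RunsLE d x) :
    ∃ l, IsDeletion d w S l ∧ l.Pairwise (· ≤ ·) ∧ w.restrict (S \ l.toFinset) = x := by
  obtain ⟨T, hT, rfl, hright⟩ := exists_isRightmost hS h
  have hsdiff : S \ (S \ T).sort.toFinset = T := by
    rw [Finset.sort_toFinset, Finset.sdiff_sdiff_eq_self hT]
  refine ⟨(S \ T).sort, ?_, Finset.pairwise_sort _ _, by rw [hsdiff]⟩
  exact IsRightmost.isDeletion hS (by simp) (Finset.sortedLT_sort _).pairwise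
    (hsdiff.symm ▸ hright) hdS (hsdiff.symm ▸ hdx)

namespace IsDeletion

variable {l : List ℕ}

theorem toFinset_subset (h : IsDeletion d w S l) : l.toFinset ⊆ S := by
  induction l generalizing S with
  | nil => simp
  | cons i l ih =>
    rw [List.toFinset_cons]
    exact Finset.insert_subset h.1.1 ((ih h.2.2).trans (Finset.erase_subset _ _))

theorem nodup (h : IsDeletion d w S l) : l.Nodup := by
  induction l generalizing S with
  | nil => exact List.nodup_nil
  | cons i l ih =>
    refine List.nodup_cons.2 ⟨fun hi => ?_, ih h.2.2⟩
    exact Finset.notMem_erase i S (h.2.2.toFinset_subset (List.mem_toFinset.2 hi))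

theorem card_sdiff_add_length (h : IsDeletion d w S l) :
    (S \ l.toFinset).card + l.length = S.card := by
  rw [← List.toFinset_card_of_nodup h.nodup, Finset.card_sdiff_add_card_eq_card h.toFinset_subset]

theorem isRightmost (h : IsDeletion d w S l) (hl : l.Pairwise (· ≤ ·)) :
    IsRightmost w S (S \ l.toFinset) := by
  induction l generalizing S with
  | nil => exact fun i hi hiT => absurd (by simpa using hi) hiT
  | cons i l ih =>
    rw [List.pairwise_cons] at hl
    rw [sdiff_toFinset_cons]
    intro j hj hjT
    by_cases hji : j = i
    · subst hji
      refine (startsRun_congr fun k hk => ?_).1 h.1.2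
      have hkl : k ∉ l := fun hkl => (hl.1 k hkl).not_gt hk
      simp [hkl, hk.ne]
    · exact ih h.2.2 hl.2 j (Finset.mem_erase.2 ⟨hji, hj⟩) hjT

theorem eq_of_increasing {l' : List ℕ} (hS : S ⊆ Finset.Icc 1 w.length) (h : IsDeletion d w S l)
    (hl : l.Pairwise (· ≤ ·)) (h' : IsDeletion d w S l') (hl' : l'.Pairwise (· ≤ ·))
    (heq : w.restrict (S \ l'.toFinset) = w.restrict (S \ l.toFinset)) : l' = l := by
  have hsdiff := (h.isRightmost hl).unique hS Finset.sdiff_subset Finset.sdiff_subset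
    (h'.isRightmost hl') heq
  have htoFinset : l'.toFinset = l.toFinset := by
    rw [← Finset.sdiff_sdiff_eq_self h'.toFinset_subset, hsdiff,
      Finset.sdiff_sdiff_eq_self h.toFinset_subset]
  rw [← (List.toFinset_sort _ h'.nodup).2 hl', htoFinset, (List.toFinset_sort _ h.nodup).2 hl]

theorem lex_of_increasing {l' : List ℕ} (hS : S ⊆ Finset.Icc 1 w.length) (h : IsDeletion d w S l)
    (hl : l.Pairwise (· ≤ ·)) (h' : IsDeletion d w S l')
    (heq : w.restrict (S \ l'.toFinset) = w.restrict (S \ l.toFinset)) (hne : l' ≠ l) :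
    List.Lex (· < ·) l l' := by
  have hlen : l'.length = l.length := by
    have hcard := card_eq_of_restrict_eq (Finset.sdiff_subset.trans hS)
      (Finset.sdiff_subset.trans hS) heq
    have := h.card_sdiff_add_length
    have := h'.card_sdiff_add_length
    omega
  induction l generalizing S l' with
  | nil => exact absurd (List.length_eq_zero_iff.1 hlen) hne
  | cons i l ih =>
    obtain ⟨i', l', rfl⟩ := List.exists_of_length_succ l' hlen
    have hle : i ≤ i' := (h.isRightmost hl).le_of_notMem hS Finset.sdiff_subset
      (fun j hj hji => mem_sdiff_toFinset_cons_of_lt hl hj hji) Finset.sdiff_subset heq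
      h'.1.1 (by simp)
    rcases hle.lt_or_eq with hlt | rfl
    · exact List.Lex.rel hlt
    · rw [sdiff_toFinset_cons, sdiff_toFinset_cons] at heq
      exact List.Lex.cons (ih ((Finset.erase_subset _ _).trans hS) h.2.2 hl.of_cons h'.2.2 heq
        (fun e => hne (e ▸ rfl)) (Nat.succ_injective hlen))

end IsDeletion

end Word

/-! ### Björner's labeling is a dual CL-labeling -/

namespace Word

variable {d : ℕ} {w x : Word} {S : Finset ℕ} {i j : ℕ}

theorem length_lt_of_lt {u v : Word} (h : u < v) : u.length < v.length := by
  refine lt_of_le_of_ne (List.Sublist.length_le h.le) fun he => h.ne ?_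
  exact Word.ext (List.Sublist.eq_of_length h.le he)

theorem covBy_of_length {u v : Word} (h : u ≤ v) (hl : u.length + 1 = v.length) : u ⋖ v := by
  refine ⟨h.lt_of_ne fun e => ?_, fun z h1 h2 => ?_⟩
  · subst e
    omega
  · have := length_lt_of_lt h1
    have := length_lt_of_lt h2
    omega

theorem restrict_erase_eq_of_not_isRunHead (hS : S ⊆ Finset.Icc 1 w.length) (hi : i ∈ S)
    (h : ¬ IsRunHead w S i) : ∃ j ∈ S, j < i ∧ w.restrict (S.erase j) = w.restrict (S.erase i) := by
  simp only [IsRunHead, StartsRun, hi, true_and, not_forall, not_not] at h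
  obtain ⟨j, ⟨⟨hj, hji⟩, hpred⟩, hw⟩ := h
  have hgap (k : ℕ) (hk : k ∈ S.erase i) (hjk : j < k) : i < k := by
    obtain ⟨hki, hk⟩ := Finset.mem_erase.1 hk
    have := mt (fun h => hpred ⟨hk, h⟩) hjk.not_ge
    omega
  have hswap : S.erase j = insert i ((S.erase i).erase j) := by
    ext k
    simp only [Finset.mem_erase, Finset.mem_insert]
    grind
  refine ⟨j, hj, hji, ?_⟩
  rw [hswap, restrict_swap ((Finset.erase_subset _ _).trans hS)
    (Finset.mem_erase.2 ⟨hji.ne, hj⟩) (hS hi) hji hgap hw]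

theorem IsRunHead.isRightmost_erase (h : IsRunHead w S i) : IsRightmost w S (S.erase i) := by
  intro j hj hjS
  obtain rfl : j = i := by_contra fun hne => hjS (Finset.mem_erase.2 ⟨hne, hj⟩)
  exact (startsRun_congr fun k hk => by simp [hk.ne]).2 h.2

theorem IsRunHead.sInf_eq (hS : S ⊆ Finset.Icc 1 w.length) (h : IsRunHead w S i) :
    sInf {j : ℕ | j ∈ S ∧ IsEmbedding (w.restrict (S.erase i)) w (S.erase j)} = i := by
  have hmem : i ∈ {j : ℕ | j ∈ S ∧ IsEmbedding (w.restrict (S.erase i)) w (S.erase j)} :=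
    ⟨h.1, (Finset.erase_subset _ _).trans hS, rfl⟩
  obtain ⟨hj, -, heq⟩ := Nat.sInf_mem ⟨i, hmem⟩
  exact (Nat.sInf_le hmem).antisymm (h.isRightmost_erase.le_of_notMem hS (Finset.erase_subset _ _)
    (fun k hk hki => Finset.mem_erase.2 ⟨hki.ne, hk⟩) (Finset.erase_subset _ _) heq hj (by simp))

theorem isRunHead_sInf (hS : S ⊆ Finset.Icc 1 w.length) (hx : x ≤ w.restrict S)
    (hl : x.length + 1 = (w.restrict S).length) :
    IsRunHead w S (sInf {j : ℕ | j ∈ S ∧ IsEmbedding x w (S.erase j)}) ∧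
      w.restrict (S.erase (sInf {j : ℕ | j ∈ S ∧ IsEmbedding x w (S.erase j)})) = x := by
  obtain ⟨T, hT, rfl⟩ := exists_restrict_eq_of_le hS hx
  rw [length_restrict hS, length_restrict (hT.trans hS)] at hl
  obtain ⟨i, hi, rfl⟩ := Finset.exists_eq_insert_iff.2 ⟨hT, hl⟩
  set A := {j : ℕ | j ∈ insert i T ∧ IsEmbedding (w.restrict T) w ((insert i T).erase j)}
  have hiA : i ∈ A := ⟨Finset.mem_insert_self i T, (Finset.erase_subset _ _).trans hS,
    by rw [Finset.erase_insert hi]⟩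
  obtain ⟨hmem, -, heq⟩ := Nat.sInf_mem ⟨i, hiA⟩
  refine ⟨by_contra fun hno => ?_, heq⟩
  obtain ⟨j, hj, hjlt, hje⟩ := restrict_erase_eq_of_not_isRunHead hS hmem hno
  exact hjlt.not_ge (Nat.sInf_le ⟨hj, (Finset.erase_subset _ _).trans hS, hje.trans heq⟩)

end Word

namespace RestrictedWord

open Word

variable {d : ℕ} {x y u w : RestrictedWord d}

theorem exists_length_add_one_eq_of_lt (h : x < y) :
    ∃ z : RestrictedWord d, x ≤ z ∧ z ≤ y ∧ z.1.length + 1 = y.1.length := by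
  have hy := restrict_full y.1
  obtain ⟨l, hl, -, hx⟩ := exists_increasing_isDeletion (d := d) (x := x.1) subset_rfl
    (hy.symm ▸ y.2) (hy.symm ▸ h.le) x.2
  cases l with
  | nil =>
    rw [List.toFinset_nil, Finset.sdiff_empty, hy] at hx
    exact absurd (Subtype.ext hx.symm) h.ne
  | cons i l =>
    refine ⟨⟨y.1.restrict ((Finset.Icc 1 y.1.length).erase i), hl.2.1⟩, ?_, ?_, ?_⟩
    · rw [sdiff_toFinset_cons] at hx
      exact hx.symm.le.trans (restrict_mono _ Finset.sdiff_subset)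
    · exact (restrict_mono _ (Finset.erase_subset _ _)).trans_eq hy
    · rw [length_restrict (Finset.erase_subset _ _), Finset.card_erase_add_one hl.1.1,
        Nat.card_Icc, Nat.add_sub_cancel]

theorem covBy_iff : x ⋖ y ↔ x ≤ y ∧ x.1.length + 1 = y.1.length := by
  constructor
  · intro h
    obtain ⟨z, hxz, hzy, hlen⟩ := exists_length_add_one_eq_of_lt h.lt
    rcases h.eq_or_eq hxz hzy with rfl | rfl
    · exact ⟨h.le, hlen⟩
    · omega
  · rintro ⟨h, hlen⟩
    have hcov := covBy_of_length (u := x.1) (v := y.1) h hlen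
    exact ⟨h.lt_of_ne fun e => hcov.ne (congrArg _ e), fun z h1 h2 => hcov.2 h1 h2⟩

/-- The poset `A*_d` is graded by the length of the words. -/
instance instGradeOrder (d : ℕ) : GradeOrder ℕ (RestrictedWord d) where
  grade x := x.1.length
  grade_strictMono _ _ h := length_lt_of_lt h
  covBy_grade _ _ h := Nat.covBy_iff_add_one_eq.2 (covBy_iff.1 h).2

theorem isMaximalChain_map_val {l : List (RestrictedWord d)} (h : IsMaximalChain u w l) :
    IsMaximalChain u.1 w.1 (l.map Subtype.val) := by
  refine ⟨?_, by rw [List.head?_map, h.2.1, Option.map_some],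
    by rw [List.getLast?_map, h.2.2, Option.map_some]⟩
  rw [List.isChain_map]
  refine h.1.imp fun x y hxy => ?_
  obtain ⟨hle, hlen⟩ := covBy_iff.1 hxy
  exact covBy_of_length hle hlen

end RestrictedWord

section Labels

open Word

variable {d : ℕ}

theorem deletionLabels_append (w : Word) (S : Finset ℕ) (xs ys : List Word) :
    deletionLabels w S (xs ++ ys) = deletionLabels w S xs ++
      deletionLabels w (S \ (deletionLabels w S xs).toFinset) ys := by
  induction xs generalizing S with
  | nil => simp [deletionLabels]
  | cons x xs ih => simp only [List.cons_append, deletionLabels, ih, sdiff_toFinset_cons]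

theorem length_deletionLabels (w : Word) (S : Finset ℕ) (xs : List Word) :
    (deletionLabels w S xs).length = xs.length := by
  induction xs generalizing S with
  | nil => rfl
  | cons x xs ih => simp only [deletionLabels, List.length_cons, ih]

theorem restrictedLabeling_cons (w : RestrictedWord d) (xs : List (RestrictedWord d)) :
    restrictedLabeling d (w :: xs) =
      (deletionLabels w.1 (Finset.Icc 1 w.1.length) (xs.map Subtype.val)).map
        (Nat.cast : ℕ → ℤ) := by
  simp [restrictedLabeling, bjornerLabeling, List.map_eq_flatMap]

theorem isTopDetermined_restrictedLabeling : IsTopDetermined (restrictedLabeling d) := by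
  intro r t hr
  obtain ⟨w, r, rfl⟩ := List.exists_cons_of_ne_nil hr
  rw [List.cons_append, restrictedLabeling_cons, restrictedLabeling_cons, List.map_append,
    deletionLabels_append, List.map_append]
  exact List.take_left' (by simp [length_deletionLabels])

theorem rootedLabels_restrictedLabeling (w y : RestrictedWord d)
    (rs xs t : List (RestrictedWord d)) :
    rootedLabels (restrictedLabeling d) (w :: rs) (y :: xs) t =
      (deletionLabels w.1 (Finset.Icc 1 w.1.length \
        (deletionLabels w.1 (Finset.Icc 1 w.1.length) (rs.map Subtype.val)).toFinset)
        (xs.map Subtype.val)).map (Nat.cast : ℕ → ℤ) := by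
  simp only [rootedLabels, List.tail_cons, List.cons_append, restrictedLabeling_cons,
    List.map_append, deletionLabels_append, List.append_assoc]
  rw [List.drop_left' (by simp [length_deletionLabels]),
    List.take_left' (by simp [length_deletionLabels])]

end Labels

section Chains

open Word

variable {d : ℕ} {w : Word} {S : Finset ℕ} {x y : RestrictedWord d}
  {xs xs' : List (RestrictedWord d)}

theorem isDeletion_deletionLabels (hS : S ⊆ Finset.Icc 1 w.length) (hy : w.restrict S = y.1)
    (h : IsMaximalChain x y (y :: xs)) :
    IsDeletion d w S (deletionLabels w S (xs.map Subtype.val)) ∧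
      w.restrict (S \ (deletionLabels w S (xs.map Subtype.val)).toFinset) = x.1 := by
  induction xs generalizing S y with
  | nil =>
    obtain rfl : y = x := Option.some.inj h.2.2
    exact ⟨trivial, by simpa [deletionLabels] using hy⟩
  | cons z xs ih =>
    obtain ⟨hcov, hz⟩ := IsMaximalChain.cons_cons_iff.1 h
    obtain ⟨hle, hlen⟩ := RestrictedWord.covBy_iff.1 hcov
    obtain ⟨hhead, heq⟩ := isRunHead_sInf hS (x := z.1) (hy.symm ▸ hle) (hy.symm ▸ hlen)
    obtain ⟨hl, hx⟩ := ih ((Finset.erase_subset _ _).trans hS) heq hz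
    simp only [List.map_cons, deletionLabels, sdiff_toFinset_cons]
    exact ⟨⟨hhead, heq.symm ▸ z.2, hl⟩, hx⟩

theorem exists_deletionLabels_eq (hS : S ⊆ Finset.Icc 1 w.length) (hy : w.restrict S = y.1)
    {l : List ℕ} (h : IsDeletion d w S l) (hx : w.restrict (S \ l.toFinset) = x.1) :
    ∃ xs : List (RestrictedWord d), IsMaximalChain x y (y :: xs) ∧
      deletionLabels w S (xs.map Subtype.val) = l := by
  induction l generalizing S y with
  | nil =>
    rw [List.toFinset_nil, Finset.sdiff_empty, hy] at hx
    obtain rfl : y = x := Subtype.ext hx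
    exact ⟨[], IsMaximalChain.self_iff.2 rfl, rfl⟩
  | cons i l ih =>
    have hSi : S.erase i ⊆ Finset.Icc 1 w.length := (Finset.erase_subset _ _).trans hS
    let z : RestrictedWord d := ⟨w.restrict (S.erase i), h.2.1⟩
    rw [sdiff_toFinset_cons] at hx
    obtain ⟨xs, hchain, hlabels⟩ := ih (y := z) hSi rfl h.2.2 hx
    have hzy : z ≤ y := (restrict_mono w (Finset.erase_subset i S)).trans_eq hy
    have hlen : z.1.length + 1 = y.1.length := by
      rw [← hy, length_restrict hSi, length_restrict hS, Finset.card_erase_add_one h.1.1]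
    refine ⟨z :: xs,
      IsMaximalChain.cons_cons_iff.2 ⟨RestrictedWord.covBy_iff.2 ⟨hzy, hlen⟩, hchain⟩, ?_⟩
    simp only [List.map_cons, deletionLabels, z, h.1.sInf_eq hS, hlabels]

theorem eq_of_deletionLabels_eq (hS : S ⊆ Finset.Icc 1 w.length) (hy : w.restrict S = y.1)
    (h : IsMaximalChain x y (y :: xs)) (h' : IsMaximalChain x y (y :: xs'))
    (heq : deletionLabels w S (xs.map Subtype.val) = deletionLabels w S (xs'.map Subtype.val)) :
    xs = xs' := by
  have hlen : xs'.length = xs.length := by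
    simpa only [length_deletionLabels, List.length_map] using (congrArg List.length heq).symm
  induction xs generalizing S y xs' with
  | nil => exact (List.length_eq_zero_iff.1 hlen).symm
  | cons z xs ih =>
    obtain ⟨z', xs', rfl⟩ := List.exists_of_length_succ xs' hlen
    obtain ⟨hcov, hz⟩ := IsMaximalChain.cons_cons_iff.1 h
    obtain ⟨hcov', hz'⟩ := IsMaximalChain.cons_cons_iff.1 h'
    obtain ⟨hle, hl⟩ := RestrictedWord.covBy_iff.1 hcov
    obtain ⟨hle', hl'⟩ := RestrictedWord.covBy_iff.1 hcov'
    have hrestrict := (isRunHead_sInf hS (x := z.1) (hy.symm ▸ hle) (hy.symm ▸ hl)).2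
    have hrestrict' := (isRunHead_sInf hS (x := z'.1) (hy.symm ▸ hle') (hy.symm ▸ hl')).2
    simp only [List.map_cons, deletionLabels, List.cons.injEq] at heq
    rw [heq.1] at hrestrict
    obtain rfl : z = z' := Subtype.ext (hrestrict.symm.trans hrestrict')
    rw [ih ((Finset.erase_subset _ _).trans hS) hrestrict' hz hz' heq.2 (Nat.succ_injective hlen)]

theorem bijOn_deletionLabels (hS : S ⊆ Finset.Icc 1 w.length) (hy : w.restrict S = y.1) :
    Set.BijOn (fun xs : List (RestrictedWord d) => deletionLabels w S (xs.map Subtype.val))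
      {xs | IsMaximalChain x y (y :: xs)}
      {l | IsDeletion d w S l ∧ w.restrict (S \ l.toFinset) = x.1} :=
  ⟨fun _ h => isDeletion_deletionLabels hS hy h,
    fun _ h _ h' heq => eq_of_deletionLabels_eq hS hy h h' heq,
    fun _ h => exists_deletionLabels_eq hS hy h.1 h.2⟩

theorem exists_lex_least_increasing_chain (hS : S ⊆ Finset.Icc 1 w.length)
    (hy : w.restrict S = y.1) (hxy : x ≤ y) :
    ∃ xs : List (RestrictedWord d), IsMaximalChain x y (y :: xs) ∧
      (deletionLabels w S (xs.map Subtype.val)).Pairwise (· ≤ ·) ∧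
      ∀ xs' : List (RestrictedWord d), IsMaximalChain x y (y :: xs') → xs' ≠ xs →
        ¬ (deletionLabels w S (xs'.map Subtype.val)).Pairwise (· ≤ ·) ∧
        List.Lex (· < ·) (deletionLabels w S (xs.map Subtype.val))
          (deletionLabels w S (xs'.map Subtype.val)) := by
  obtain ⟨hmaps, hinj, hsurj⟩ := bijOn_deletionLabels (x := x) hS hy
  obtain ⟨l, hl, hincr, hx⟩ := exists_increasing_isDeletion hS (hy.symm ▸ y.2)
    (x := x.1) (hy.symm ▸ hxy) x.2
  obtain ⟨xs, hxs, rfl⟩ := hsurj ⟨hl, hx⟩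
  refine ⟨xs, hxs, hincr, fun xs' hxs' hne => ?_⟩
  obtain ⟨hl', hx'⟩ := hmaps hxs'
  have hne' := mt (fun e => hinj hxs' hxs e) hne
  have heq := hx'.trans hx.symm
  exact ⟨fun hincr' => hne' (hl.eq_of_increasing hS hincr hl' hincr' heq),
    hl.lex_of_increasing hS hincr hl' heq hne'⟩

theorem pairwise_map_natCast_iff {l : List ℕ} :
    (l.map (Nat.cast : ℕ → ℤ)).Pairwise (· ≤ ·) ↔ l.Pairwise (· ≤ ·) := by
  simp only [List.pairwise_map, Nat.cast_le]

theorem lex_map_natCast {l l' : List ℕ} (h : List.Lex (· < ·) l l') :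
    List.Lex (· < ·) (l.map (Nat.cast : ℕ → ℤ)) (l'.map (Nat.cast : ℕ → ℤ)) := by
  induction h with
  | nil => exact List.Lex.nil
  | cons _ ih => exact List.Lex.cons ih
  | rel h => exact List.Lex.rel (Nat.cast_lt.2 h)

theorem isDualCLLabeling_restrictedLabeling (u w : RestrictedWord d) :
    IsDualCLLabeling u w (restrictedLabeling d) where
  graded l l' hl hl' := by
    have := hl.grade_add_one
    have := hl'.grade_add_one
    omega
  length_eq l hl := by
    obtain ⟨xs, rfl⟩ := hl.exists_cons
    simp [restrictedLabeling_cons, length_deletionLabels]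
  prefix_eq l l' _ _ s hs h := by
    have hlabels (l : List (RestrictedWord d)) (hs : s < l.length) :
        (restrictedLabeling d l).take s = restrictedLabeling d (l.take (s + 1)) := by
      have := isTopDetermined_restrictedLabeling (l.take (s + 1)) (l.drop (s + 1))
        (List.ne_nil_of_length_pos (by rw [List.length_take]; omega))
      rwa [List.take_append_drop, List.length_take, min_eq_left (by omega),
        Nat.add_sub_cancel] at this
    have := congrArg List.length h
    rw [List.length_take, List.length_take] at this
    rw [hlabels l hs, hlabels l' (by omega), h]
  rooted x y _ hxy _ r t hr _ := by
    obtain ⟨rs, rfl⟩ := hr.exists_cons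
    have hy := (isDeletion_deletionLabels subset_rfl (restrict_full w.1) hr).2
    obtain ⟨xs, hxs, hincr, hleast⟩ :=
      exists_lex_least_increasing_chain Finset.sdiff_subset hy hxy
    refine ⟨y :: xs, hxs, ?_, fun m' hm' hne => ?_⟩
    · rwa [rootedLabels_restrictedLabeling, pairwise_map_natCast_iff]
    · obtain ⟨xs', rfl⟩ := hm'.exists_cons
      obtain ⟨hnot, hlex⟩ := hleast xs' hm' fun e => hne (e ▸ rfl)
      rw [rootedLabels_restrictedLabeling, rootedLabels_restrictedLabeling,
        pairwise_map_natCast_iff]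
      exact ⟨hnot, lex_map_natCast hlex⟩

end Chains

/-! ### Decreasing deletions and normal embeddings -/

namespace Word

variable {d : ℕ} {u w : Word} {S T U : Finset ℕ} {h i j k p q : ℕ}

theorem isRunHead_erase_iff (hji : j < i) : IsRunHead w (S.erase i) j ↔ IsRunHead w S j :=
  and_congr (by simp [hji.ne]) (startsRun_congr fun k hk => by simp [(hk.trans hji).ne])

/-- The positions that remain when the elements of `S \ T` have been deleted from right to left
down to `i`. -/
def positionsAfter (S T : Finset ℕ) (i : ℕ) : Finset ℕ :=
  S.filter (· < i) ∪ T.filter (i < ·)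

theorem mem_positionsAfter : k ∈ positionsAfter S T i ↔ (k ∈ S ∧ k < i) ∨ (k ∈ T ∧ i < k) := by
  simp [positionsAfter]

theorem positionsAfter_subset (hT : T ⊆ S) : positionsAfter S T i ⊆ S :=
  Finset.union_subset (Finset.filter_subset _ _) ((Finset.filter_subset _ _).trans hT)

theorem positionsAfter_erase (hji : j < i) :
    positionsAfter (S.erase i) T j = positionsAfter S T j := by
  ext k
  simp only [mem_positionsAfter, Finset.mem_erase]
  grind

theorem positionsAfter_eq_erase (hT : T ⊆ S) (hmax : ∀ k ∈ S, i < k → k ∈ T) :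
    positionsAfter S T i = S.erase i := by
  ext k
  have := @hT k
  have := hmax k
  simp only [mem_positionsAfter, Finset.mem_erase]
  grind

theorem isDeletion_iff_of_decreasing {l : List ℕ} (hl : l.Pairwise (· > ·)) :
    IsDeletion d w S l ↔ ∀ i ∈ l, IsRunHead w S i ∧
      RunsLE d (w.restrict (positionsAfter S (S \ l.toFinset) i)) := by
  induction l generalizing S with
  | nil => simp [IsDeletion]
  | cons i l ih =>
    obtain ⟨hlt, hl⟩ := List.pairwise_cons.1 hl
    have hfirst : positionsAfter S (S \ (i :: l).toFinset) i = S.erase i := by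
      refine positionsAfter_eq_erase Finset.sdiff_subset fun k hk hik => Finset.mem_sdiff.2 ⟨hk, ?_⟩
      have := mt (hlt k) hik.asymm
      simp [hik.ne', this]
    rw [IsDeletion, ih hl, List.forall_mem_cons, hfirst, sdiff_toFinset_cons, and_assoc]
    refine and_congr_right fun _ => and_congr_right fun _ => forall₂_congr fun j hj => ?_
    rw [isRunHead_erase_iff (hlt j hj), positionsAfter_erase (hlt j hj)]

theorem bijOn_sdiff_toFinset : Set.BijOn (fun l : List ℕ => S \ l.toFinset)
    {l | IsDeletion d w S l ∧ l.Pairwise (· > ·)}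
    {T | T ⊆ S ∧ ∀ i ∈ S \ T, IsRunHead w S i ∧ RunsLE d (w.restrict (positionsAfter S T i))} := by
  refine ⟨fun l ⟨hdel, hl⟩ => ⟨Finset.sdiff_subset, fun i hi => ?_⟩,
    fun l ⟨hdel, hl⟩ l' ⟨hdel', hl'⟩ heq => ?_, fun T ⟨hT, hall⟩ => ?_⟩
  · rw [Finset.sdiff_sdiff_eq_self hdel.toFinset_subset, List.mem_toFinset] at hi
    exact (isDeletion_iff_of_decreasing hl).1 hdel i hi
  · have hsdiff : S \ l.toFinset = S \ l'.toFinset := heq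
    have htoFinset : l.toFinset = l'.toFinset := by
      rw [← Finset.sdiff_sdiff_eq_self hdel.toFinset_subset, hsdiff,
        Finset.sdiff_sdiff_eq_self hdel'.toFinset_subset]
    exact (List.perm_of_nodup_nodup_toFinset_eq hdel.nodup hdel'.nodup htoFinset).eq_of_pairwise'
      hl hl'
  · have hsdiff : S \ ((S \ T).sort (· ≥ ·)).toFinset = T := by
      rw [Finset.sort_toFinset, Finset.sdiff_sdiff_eq_self hT]
    have hl : ((S \ T).sort (· ≥ ·)).Pairwise (· > ·) := (Finset.sortedGT_sort _).pairwise
    refine ⟨(S \ T).sort (· ≥ ·), ⟨(isDeletion_iff_of_decreasing hl).2 fun i hi => ?_, hl⟩, hsdiff⟩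
    rw [hsdiff]
    exact hall i ((Finset.mem_sort _).1 hi)

theorem isRunHead_full_iff (hi : i ∈ Finset.Icc 1 w.length) :
    IsRunHead w (Finset.Icc 1 w.length) i ↔ i ∉ w.repetitionSet := by
  have hi' := Finset.mem_Icc.1 hi
  simp only [IsRunHead, hi, true_and, repetitionSet, Finset.mem_filter, Finset.mem_Icc]
  constructor
  · rintro hstart ⟨h2, heq⟩
    exact hstart (i - 1) ⟨⟨Finset.mem_Icc.2 ⟨by omega, by omega⟩, by omega⟩,
      fun k hk => Nat.le_sub_one_of_lt hk.2⟩ heq.symm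
  · rintro hi t ⟨⟨ht, hti⟩, hpred⟩ heq
    have ht' := Finset.mem_Icc.1 ht
    have := hpred (a := i - 1) ⟨Finset.mem_Icc.2 ⟨by omega, by omega⟩, by omega⟩
    obtain rfl : t = i - 1 := by omega
    exact hi ⟨by omega, heq.symm⟩

theorem letterAt_eq_a_or_b (hi : i ∈ Finset.Icc 1 w.length) :
    w.letterAt i = some Letter.a ∨ w.letterAt i = some Letter.b := by
  obtain ⟨c, hc⟩ := exists_mem_zipIdx hi
  rw [(letterAt_mem_zipIdx hc).1]
  cases c <;> simp

theorem RunsLE.pos (h : RunsLE d w) (hp : w.letterAt p = some Letter.b) : 0 < d := by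
  refine Nat.pos_of_ne_zero fun hd => runsLE_iff.1 (hd ▸ h) p ⟨hp, fun t ht => ?_⟩
  obtain rfl : t = 0 := by omega
  exact hp

/-- The admissible places `p` for the first letter of a run of `d` letters `b` in a `d`-normal
embedding at the positions `T`. -/
def IsSupported (w : Word) (T : Finset ℕ) (p : ℕ) : Prop :=
  (w.letterAt (p - 1) = some Letter.a ∧ p - 1 ∈ T) ∨ p = 1 ∨
    (p = 2 ∧ w.letterAt 1 = some Letter.a ∧ 1 ∉ T)

theorem isNormalEmbedding_iff_isSupported : IsNormalEmbedding d u w T ↔ IsEmbedding u w T ∧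
    w.repetitionSet ⊆ T ∧ ∀ p ∈ T, BRunAt d u (rank T p) → IsSupported w T p := by
  have hrank {p q : ℕ} (hp : p ∈ T) (hq : q ∈ T) (hpq : p < q) : 1 < rank T q :=
    (Finset.mem_Icc.1 (rank_mem_Icc hp)).1.trans_lt (rank_lt_rank hq hpq)
  constructor
  · rintro ⟨hemb, hR, hinner, hinitial⟩
    refine ⟨hemb, hR, fun p hp hrun => ?_⟩
    rcases (Finset.mem_Icc.1 (rank_mem_Icc hp)).1.lt_or_eq' with h1 | h1
    · exact Or.inl (hinner p hp h1 hrun)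
    · refine Or.inr ((hinitial p hp h1 (h1 ▸ hrun)).imp_right fun ⟨hp2, ha⟩ => ⟨hp2, ha, ?_⟩)
      exact fun h => (hrank h hp (by omega)).ne' h1
  · rintro ⟨hemb, hR, hsupp⟩
    have hpos {p : ℕ} (hp : p ∈ T) : 1 ≤ p := (Finset.mem_Icc.1 (hemb.1 hp)).1
    refine ⟨hemb, hR, fun p hp h1 hrun => ?_, fun p hp h1 hrun => ?_⟩
    · obtain ⟨q, hq, hq1⟩ := exists_rank_eq le_rfl
        ((Finset.mem_Icc.1 (rank_mem_Icc hp)).1.trans (Finset.mem_Icc.1 (rank_mem_Icc hp)).2)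
      have hqp : q < p := by
        by_contra! hpq
        exact ((rank_mono T hpq).trans hq1.le).not_gt h1
      have := hpos hq
      refine (hsupp p hp hrun).resolve_right ?_
      rintro (rfl | ⟨rfl, -, h⟩)
      · omega
      · obtain rfl : q = 1 := by omega
        exact h hq
    · rcases hsupp p hp (by rwa [rank, h1]) with ⟨-, hpred⟩ | rfl | ⟨h2, ha, -⟩
      · have := hpos hp
        exact absurd h1 (hrank hpred hp (by omega)).ne'
      · exact Or.inl rfl
      · exact Or.inr ⟨h2, ha⟩

theorem card_inter_Ioc_lt (hT : T ⊆ Finset.Icc 1 w.length) (hdw : RunsLE d w)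
    (hsupp : ∀ p ∈ T, BRunAt d (w.restrict T) (rank T p) → IsSupported w T p)
    (hi : i ∉ T) (hib : w.letterAt i = some Letter.b) (hblock : IsBBlock w T i q) :
    (T ∩ Finset.Ioc i q).card < d := by
  by_contra! hcard
  have hne := Finset.card_pos.1 ((hdw.pos hib).trans_le hcard)
  obtain ⟨p, hp, hmin⟩ := Finset.exists_min_image _ id hne
  simp only [Finset.mem_inter, Finset.mem_Ioc, id_eq, and_imp] at hp hmin
  obtain ⟨hpT, hip, hpq⟩ := hp
  have hi1 := (Finset.mem_Icc.1 (mem_Icc_of_letterAt_eq_some hib)).1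
  have hsub : T ∩ Finset.Ioc i q ⊆ T ∩ Finset.Icc p q := fun k hk => by
    simp only [Finset.mem_inter, Finset.mem_Ioc, Finset.mem_Icc] at hk ⊢
    exact ⟨hk.1, hmin k hk.1 hk.2.1 hk.2.2, hk.2.2⟩
  have hrun : BRunAt d (w.restrict T) (rank T p) := (bRunAt_restrict_rank_iff hT hpT).2
    ⟨hblock p hpT hip.le hpq, q, fun k hk hpk => hblock k hk (hip.le.trans hpk),
      hcard.trans (Finset.card_le_card hsub)⟩
  rcases hsupp p hpT hrun with ⟨-, hpred⟩ | h1 | ⟨h2, ha, -⟩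
  · have hne : p - 1 ≠ i := fun h => hi (h ▸ hpred)
    have := hmin (p - 1) hpred (by omega) (by omega)
    omega
  · omega
  · obtain rfl : i = 1 := by omega
    simp [ha] at hib

theorem card_positionsAfter_inter_Icc_le (hT : T ⊆ Finset.Icc 1 w.length) (hdw : RunsLE d w)
    (hdT : RunsLE d (w.restrict T)) (hR : w.repetitionSet ⊆ T)
    (hsupp : ∀ p ∈ T, BRunAt d (w.restrict T) (rank T p) → IsSupported w T p)
    (hi : i ∈ Finset.Icc 1 w.length) (hiT : i ∉ T) (hp : 1 ≤ p) (hpi : p < i) (hiq : i ≤ q)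
    (hblock : IsBBlock w (positionsAfter (Finset.Icc 1 w.length) T i) p q) :
    (positionsAfter (Finset.Icc 1 w.length) T i ∩ Finset.Icc p q).card ≤ d := by
  have hin := (Finset.mem_Icc.1 hi).2
  simp only [IsBBlock, mem_positionsAfter] at hblock
  have hblock_left (k : ℕ) (hpk : p ≤ k) (hki : k < i) : w.letterAt k = some Letter.b :=
    hblock k (Or.inl ⟨Finset.mem_Icc.2 ⟨by omega, by omega⟩, hki⟩) hpk (by omega)
  have hmem_left (k : ℕ) (hpk : p < k) (hki : k < i) : k ∈ T := by
    refine hR (Finset.mem_filter.2 ⟨Finset.mem_Icc.2 ⟨by omega, by omega⟩, ?_⟩)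
    rw [hblock_left k (by omega) hki, hblock_left (k - 1) (by omega) (by omega)]
  have hblockT : IsBBlock w T p q := fun k hk hpk hkq => by
    rcases lt_trichotomy k i with hki | rfl | hik
    · exact hblock_left k hpk hki
    · exact absurd hk hiT
    · exact hblock k (Or.inr ⟨hk, hik⟩) hpk hkq
  have hsub : positionsAfter (Finset.Icc 1 w.length) T i ∩ Finset.Icc p q ⊆
      insert p (T ∩ Finset.Ioc p q) := fun k hk => by
    simp only [Finset.mem_inter, Finset.mem_Icc, mem_positionsAfter, Finset.mem_insert,
      Finset.mem_Ioc] at hk ⊢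
    grind
  by_cases hpT : p ∈ T
  · refine (Finset.card_le_card (hsub.trans fun k hk => ?_)).trans
      ((runsLE_restrict_iff hT).1 hdT p hpT q hblockT)
    simp only [Finset.mem_inter, Finset.mem_Icc, Finset.mem_insert, Finset.mem_Ioc] at hk ⊢
    grind
  · exact (Finset.card_le_card hsub).trans ((Finset.card_insert_le _ _).trans
      (card_inter_Ioc_lt hT hdw hsupp hpT (hblock_left p le_rfl hpi) hblockT))

theorem runsLE_positionsAfter (hT : T ⊆ Finset.Icc 1 w.length) (hdw : RunsLE d w)
    (hdT : RunsLE d (w.restrict T)) (hR : w.repetitionSet ⊆ T)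
    (hsupp : ∀ p ∈ T, BRunAt d (w.restrict T) (rank T p) → IsSupported w T p)
    (hi : i ∈ Finset.Icc 1 w.length) (hiT : i ∉ T) :
    RunsLE d (w.restrict (positionsAfter (Finset.Icc 1 w.length) T i)) := by
  have hdw' := (runsLE_restrict_iff (d := d) (subset_refl (Finset.Icc 1 w.length))).1
    (by rwa [restrict_full])
  rw [runsLE_restrict_iff (positionsAfter_subset hT)]
  intro p hp q hblock
  rcases mem_positionsAfter.1 hp with ⟨hp, hpi⟩ | ⟨hp, hip⟩
  · rcases lt_or_ge q i with hqi | hiq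
    · refine (Finset.card_le_card (Finset.inter_subset_inter_right
        (positionsAfter_subset hT))).trans (hdw' p hp q fun k hk hpk hkq => hblock k ?_ hpk hkq)
      exact mem_positionsAfter.2 (Or.inl ⟨hk, hkq.trans_lt hqi⟩)
    · exact card_positionsAfter_inter_Icc_le hT hdw hdT hR hsupp hi hiT (Finset.mem_Icc.1 hp).1
        hpi hiq hblock
  · refine (Finset.card_le_card fun k hk => ?_).trans ((runsLE_restrict_iff hT).1 hdT p hp q
      fun k hk hpk => hblock k (mem_positionsAfter.2 (Or.inr ⟨hk, hip.trans_le hpk⟩)) hpk)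
    simp only [Finset.mem_inter, Finset.mem_Icc, mem_positionsAfter] at hk ⊢
    grind

theorem not_runsLE_of_prepend (hU : U ⊆ Finset.Icc 1 w.length) (hq : q ∈ U) (hqp : q < p)
    (hph : p ≤ h) (hblock : IsBBlock w U q h) (hsub : T ∩ Finset.Icc p h ⊆ U)
    (hcard : d ≤ (T ∩ Finset.Icc p h).card) : ¬ RunsLE d (w.restrict U) := by
  intro hdU
  have hle := (runsLE_restrict_iff hU).1 hdU q hq h hblock
  have hinsert : insert q (T ∩ Finset.Icc p h) ⊆ U ∩ Finset.Icc q h := by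
    refine Finset.insert_subset ?_ (Finset.subset_inter hsub
      (Finset.inter_subset_right.trans (Finset.Icc_subset_Icc_left hqp.le)))
    exact Finset.mem_inter.2 ⟨hq, Finset.left_mem_Icc.2 (hqp.le.trans hph)⟩
  have := Finset.card_le_card hinsert
  rw [Finset.card_insert_of_notMem (by simp [hqp])] at this
  omega

theorem letterAt_sub_one_ne_b (hT : T ⊆ Finset.Icc 1 w.length) (hdw : RunsLE d w)
    (hdU : ∀ i ∈ Finset.Icc 1 w.length \ T,
      RunsLE d (w.restrict (positionsAfter (Finset.Icc 1 w.length) T i)))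
    (hph : p ≤ h) (hblock : IsBBlock w T p h)
    (hcard : d ≤ (T ∩ Finset.Icc p h).card) : w.letterAt (p - 1) ≠ some Letter.b := by
  intro hb
  have hpred := mem_Icc_of_letterAt_eq_some hb
  have hpred' := Finset.mem_Icc.1 hpred
  by_cases hgap : ((Finset.Icc 1 w.length \ T) ∩ Finset.Icc p h).Nonempty
  · obtain ⟨i, hi, hmin⟩ := Finset.exists_min_image _ id hgap
    simp only [Finset.mem_inter, Finset.mem_sdiff, Finset.mem_Icc, id_eq, and_imp] at hi hmin
    refine not_runsLE_of_prepend (q := p - 1) (positionsAfter_subset hT) ?_ (by omega) hph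
      (fun k hk hpk hkh => ?_) (fun k hk => ?_) hcard (hdU i (by simp [hi]))
    · exact mem_positionsAfter.2 (Or.inl ⟨hpred, by omega⟩)
    · rcases hpk.eq_or_lt with rfl | hpk
      · exact hb
      · refine hblock k ?_ (by omega) hkh
        rw [mem_positionsAfter, Finset.mem_Icc] at hk
        grind
    · have := hT (Finset.mem_of_mem_inter_left hk)
      simp only [Finset.mem_inter, mem_positionsAfter] at hk ⊢
      grind
  · rw [Finset.not_nonempty_iff_eq_empty] at hgap
    refine not_runsLE_of_prepend (q := p - 1) subset_rfl hpred (by omega) hph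
      (fun k hk hpk hkh => ?_) (Finset.inter_subset_left.trans hT) hcard (by rwa [restrict_full])
    rcases hpk.eq_or_lt with rfl | hpk
    · exact hb
    · refine hblock k (by_contra fun hkT => Finset.notMem_empty k (hgap ▸ ?_)) (by omega) hkh
      exact Finset.mem_inter.2
        ⟨Finset.mem_sdiff.2 ⟨hk, hkT⟩, Finset.mem_Icc.2 ⟨by omega, hkh⟩⟩

theorem isSupported_of_runsLE_positionsAfter (hT : T ⊆ Finset.Icc 1 w.length) (hdw : RunsLE d w)
    (hR : w.repetitionSet ⊆ T)
    (hdU : ∀ i ∈ Finset.Icc 1 w.length \ T,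
      RunsLE d (w.restrict (positionsAfter (Finset.Icc 1 w.length) T i)))
    (hp : p ∈ T) (hrun : BRunAt d (w.restrict T) (rank T p)) : IsSupported w T p := by
  obtain ⟨hpb, h, hblock, hcard⟩ := (bRunAt_restrict_rank_iff hT hp).1 hrun
  have hph := le_of_card_inter_Icc_pos ((hdw.pos hpb).trans_le hcard)
  have hpn := Finset.mem_Icc.1 (hT hp)
  by_cases hp1 : p = 1
  · exact Or.inr (Or.inl hp1)
  have hpred : p - 1 ∈ Finset.Icc 1 w.length := Finset.mem_Icc.2 ⟨by omega, by omega⟩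
  have ha := (letterAt_eq_a_or_b hpred).resolve_right
    (letterAt_sub_one_ne_b hT hdw hdU hph hblock hcard)
  by_cases hpredT : p - 1 ∈ T
  · exact Or.inl ⟨ha, hpredT⟩
  by_cases hp2 : p = 2
  · subst hp2
    exact Or.inr (Or.inr ⟨rfl, ha, hpredT⟩)
  have hpred2 : p - 2 ∈ Finset.Icc 1 w.length := Finset.mem_Icc.2 ⟨by omega, by omega⟩
  rcases letterAt_eq_a_or_b hpred2 with ha2 | hb2
  · refine absurd (hR (Finset.mem_filter.2 ⟨Finset.mem_Icc.2 ⟨by omega, by omega⟩, ?_⟩)) hpredT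
    rw [ha, Nat.sub_sub, ha2]
  · refine absurd (hdU (p - 1) (Finset.mem_sdiff.2 ⟨hpred, hpredT⟩))
      (not_runsLE_of_prepend (q := p - 2) (positionsAfter_subset hT) ?_ (by omega) hph
        (fun k hk hpk hkh => ?_) (fun k hk => ?_) hcard)
    · exact mem_positionsAfter.2 (Or.inl ⟨hpred2, by omega⟩)
    · rcases mem_positionsAfter.1 hk with ⟨-, hk⟩ | ⟨hk, hpk⟩
      · obtain rfl : k = p - 2 := by omega
        exact hb2
      · exact hblock k hk (by omega) hkh
    · rw [Finset.mem_inter, Finset.mem_Icc] at hk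
      exact mem_positionsAfter.2 (Or.inr ⟨hk.1, by omega⟩)

theorem isNormalEmbedding_iff (hw : RunsLE d w) (hu : RunsLE d u) :
    IsNormalEmbedding d u w T ↔ IsEmbedding u w T ∧ ∀ i ∈ Finset.Icc 1 w.length \ T,
      IsRunHead w (Finset.Icc 1 w.length) i ∧
        RunsLE d (w.restrict (positionsAfter (Finset.Icc 1 w.length) T i)) := by
  rw [isNormalEmbedding_iff_isSupported]
  refine and_congr_right ?_
  rintro ⟨hT, rfl⟩
  constructor
  · rintro ⟨hR, hsupp⟩ i hi
    obtain ⟨hi, hiT⟩ := Finset.mem_sdiff.1 hi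
    exact ⟨(isRunHead_full_iff hi).2 fun h => hiT (hR h),
      runsLE_positionsAfter hT hw hu hR hsupp hi hiT⟩
  · intro hall
    have hR : w.repetitionSet ⊆ T := fun j hj => by_contra fun hjT => by
      have hj' : j ∈ Finset.Icc 1 w.length :=
        Finset.Icc_subset_Icc_left one_le_two (Finset.mem_filter.1 hj).1
      exact (isRunHead_full_iff hj').1 (hall j (Finset.mem_sdiff.2 ⟨hj', hjT⟩)).1 hj
    exact ⟨hR, fun p hp =>
      isSupported_of_runsLE_positionsAfter hT hw hR (fun i hi => (hall i hi).2) hp⟩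

end Word

theorem mem_descendingChains_iff {d : ℕ} {u w : RestrictedWord d} {xs : List (RestrictedWord d)} :
    w :: xs ∈ descendingChains d u w ↔ IsMaximalChain u w (w :: xs) ∧
      (deletionLabels w.1 (Finset.Icc 1 w.1.length) (xs.map Subtype.val)).Pairwise (· > ·) := by
  simp [descendingChains, restrictedLabeling_cons, List.pairwise_map]

theorem ncard_descendingChains {d : ℕ} (u w : RestrictedWord d) :
    (descendingChains d u w).ncard = {ι | Word.IsNormalEmbedding d u.1 w.1 ι}.ncard := by
  set S := Finset.Icc 1 w.1.length
  let D : Set (List ℕ) := {l | (Word.IsDeletion d w.1 S l ∧ w.1.restrict (S \ l.toFinset) = u.1) ∧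
    l.Pairwise (· > ·)}
  have hlabels := (bijOn_deletionLabels (x := u) subset_rfl (Word.restrict_full w.1)).subset_right
    (r := D) fun l hl => hl.1
  have hsdiff := (Word.bijOn_sdiff_toFinset (d := d) (w := w.1) (S := S)).subset_right
    (r := {ι | Word.IsNormalEmbedding d u.1 w.1 ι}) fun ι hι => by
      obtain ⟨hemb, hall⟩ := (Word.isNormalEmbedding_iff w.2 u.2).1 hι
      exact ⟨hemb.1, hall⟩
  have hchains : descendingChains d u w = (w :: ·) '' ({xs | IsMaximalChain u w (w :: xs)} ∩
      (fun xs => deletionLabels w.1 S (xs.map Subtype.val)) ⁻¹' D) := by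
    ext c
    constructor
    · intro hc
      obtain ⟨xs, rfl⟩ := hc.1.exists_cons
      have hl := isDeletion_deletionLabels subset_rfl (Word.restrict_full w.1) hc.1
      exact ⟨xs, ⟨hc.1, hl, (mem_descendingChains_iff.1 hc).2⟩, rfl⟩
    · rintro ⟨xs, ⟨hc, hl⟩, rfl⟩
      exact mem_descendingChains_iff.2 ⟨hc, hl.2⟩
  have hD : D = {l | Word.IsDeletion d w.1 S l ∧ l.Pairwise (· > ·)} ∩
      (fun l => S \ l.toFinset) ⁻¹' {ι | Word.IsNormalEmbedding d u.1 w.1 ι} := by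
    ext l
    constructor
    · rintro ⟨⟨hdel, hu⟩, hl⟩
      refine ⟨⟨hdel, hl⟩, (Word.isNormalEmbedding_iff w.2 u.2).2 ?_⟩
      exact ⟨⟨Finset.sdiff_subset, hu⟩, (Word.bijOn_sdiff_toFinset.mapsTo ⟨hdel, hl⟩).2⟩
    · rintro ⟨⟨hdel, hl⟩, hι⟩
      exact ⟨⟨hdel, hι.isEmbedding.2⟩, hl⟩
  rw [hchains, Set.ncard_image_of_injective _ List.cons_injective, hlabels.ncard_eq, hD,
    hsdiff.ncard_eq]

theorem theorem3p2 (d : ℕ) :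
    (∀ u w : RestrictedWord d, u ≤ w →
      (∀ c, IsMaximalChain u w c → IsMaximalChain u.1 w.1 (c.map Subtype.val)) ∧
      IsDualCLLabeling u w (restrictedLabeling d)) ∧
    IsDualCLShellable (RestrictedWord d) ∧
    (∀ u w : RestrictedWord d, u ≤ w → IsShellable (orderComplex u w)) ∧
    (∀ u w : RestrictedWord d,
      (descendingChains d u w).ncard = {ι | Word.IsNormalEmbedding d u.1 w.1 ι}.ncard ∧
      IncidenceAlgebra.mu ℤ u w =
        (-1) ^ (w.1.length + u.1.length) * ({ι | Word.IsNormalEmbedding d u.1 w.1 ι}.ncard : ℤ)) := by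
  have hCL := fun u w : RestrictedWord d => isDualCLLabeling_restrictedLabeling u w
  refine ⟨fun u w _ => ⟨fun c => RestrictedWord.isMaximalChain_map_val, hCL u w⟩,
    fun u w _ => ⟨_, hCL u w⟩, fun u w _ => (hCL u w).isShellable,
    fun u w => ⟨ncard_descendingChains u w, ?_⟩⟩
  rw [← ncard_descendingChains]
  exact mu_eq_ncard_descending (fun u w _ => hCL u w) isTopDetermined_restrictedLabeling u w
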